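/- Let $k\ge 4$ and $d\ge 2$ be integers. Put $w_1^*=2/k$, $w_2^*=\binom{k}{2}^{-1}$, $w^*=(w_1^*,w_2^*)$, let $H(p)=-p\ln p-(1-p)\ln(1-p)$ be the binary entropy, and let $d^*=\frac{kH(w_1^*)}{kH(w_1^*)+\ln w_2^*}$. Let $\mathcal W=\{w\in[0,1]^2: 2w_1-1\le w_2\le w_1\}$, and for $w\in\mathcal W$ let $$p(w)=\begin{pmatrix}1-2w_1+w_2\\ 2(w_1-w_2)\\ w_2\end{pmatrix},\qquad q(w)=W\,p(w),\qquad W=\begin{pmatrix}1-2w_1^*&1-\tfrac32w_1^*&1-w_1^*\\2w_1^*&w_1^*&0\\0&\tfrac12w_1^*&w_1^*\end{pmatrix}.$$ Write $p^*=p(w^*)$, $q^*=q(w^*)$ and $D_{\mathrm{KL}}(a\|b)=\sum_i a_i\ln(a_i/b_i)$. Assume the Contraction Coefficient Conjecture for $k$: the supremum $d_*$ of $D_{\mathrm{KL}}(Wp\|Wp^*)/D_{\mathrm{KL}}(p\|p^*)$ over all probability mass functions $p\ne p^*$ on $\{0,1,2\}$ is attained at $p=p(1,1)=(0,0,1)$,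 and $d_*=\frac{H(w_1^*)}{-\ln w_2^*}$. Assume also $d<d^*$. For $n$ in $\mathcal N=\{n\in\mathbb Z_{>0}: dn/k,\ 2n/k\in\mathbb Z\}$ let $m=dn/k$, and let $G$ be a uniformly random bijection $[n]\times[d]\to[m]\times[k]$ (a $d$-regular $k$-configuration). Let $Z$ be the number of $x\in\{0,1\}^n$ such that for each $a\in[m]$ there are exactly two $h\in[k]$ for which the variable $i$ in $(i,h')=G^{-1}(a,h)$ satisfies $x_i=1$. Let $$\phi_2(w)=\frac dk D_{\mathrm{KL}}(p(w)\|p^*)-(d-1)D_{\mathrm{KL}}(q(w)\|q^*),\qquad w\in\mathcal W .$$ Then $w^*$ is the unique minimizer of $\phi_2$ on $\mathcal W$, with $\phi_2(w^*)=0$. The Hessian $\mathcal H$ of $\phi_2$ at $w^*$ is $$\mathcal H=\begin{pmatrix}\dfrac{d(k^2-k+2)+k^2(k-3)}{(k-2)^2(k-3)}&-\dfrac{d(k-1)^2}{(k-2)(k-3)}\\[2mm]-\dfrac{d(k-1)^2}{(k-2)(k-3)}&\dfrac{d(k-1)^2}{2(k-3)}\end{pmatrix}.$$ As $n\to\infty$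 in $\mathcal N$, $$\frac{\mathbb E[Z^2]}{\mathbb E[Z]^2}\sim\sqrt{\frac{2}{(2\pi)^2\prod_{i=0}^2p_i(w^*)}}\,\sqrt{\frac{(2\pi)^2}{\det\left(\frac{k}{\sqrt{2d}}\mathcal H\right)}}=\sqrt{\frac{k-1}{k-d}} .$$ -/

import Mathlib

open Filter Asymptotics Topology

namespace Occupation

/-- A `d`-regular `k`-configuration on `n` variables and `m` constraints: a bijection from the
variable half-edges `(i, h)` to the constraint half-edges `(a, h')`. -/
abbrev Configuration (k d n m : ℕ) : Type := (Fin n × Fin d) ≃ (Fin m × Fin k)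

/-- The assignment `x` solves the `2`-in-`k` occupation problem on `g`: each constraint `a` has
exactly two half-edges that are wired to a variable of value one. -/
def IsSolution {k d n m : ℕ} (g : Configuration k d n m) (x : Fin n → Bool) : Prop :=
  ∀ a : Fin m, Nat.card {h : Fin k // x (g.symm (a, h)).1 = true} = 2

/-- The number `Z` of solutions on the configuration `g`. -/
noncomputable def numSolutions {k d n m : ℕ} (g : Configuration k d n m) : ℕ :=
  Nat.card {x : Fin n → Bool // IsSolution g x}

/-- The admissible `n`: those for which `d n / k` and `2 n / k` are positive integers. -/
def admissible (k d : ℕ) : Set ℕ := {n | 0 < n ∧ k ∣ d * n ∧ k ∣ 2 * n}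

/-- The moment `E[Z ^ j]` for the uniformly random `d`-regular `k`-configuration on `n` variables
and `m = d n / k` constraints (used only for `n` with `k ∣ d * n`, so the division is exact). -/
noncomputable def moment (k d j n : ℕ) : ℝ :=
  Finset.expect Finset.univ
    (fun g : Configuration k d n (d * n / k) => (numSolutions g : ℝ) ^ j)

/-- `w₁* = 2 / k`. -/
noncomputable def w1star (k : ℕ) : ℝ := 2 / (k : ℝ)

/-- `w₂* = 1 / (k choose 2)`. -/
noncomputable def w2star (k : ℕ) : ℝ := ((k.choose 2 : ℕ) : ℝ)⁻¹

/-- The threshold `d*(k) = k H(w₁*) / (k H(w₁*) + ln w₂*)`, with `H` the binary entropy. -/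
noncomputable def dstar (k : ℕ) : ℝ :=
  (k : ℝ) * Real.binEntropy (w1star k) /
    ((k : ℝ) * Real.binEntropy (w1star k) + Real.log (w2star k))

/-- The Kullback-Leibler divergence of pmfs on a finite set, for a reference pmf `b` with
full support. -/
noncomputable def kl {ι : Type*} [Fintype ι] (a b : ι → ℝ) : ℝ :=
  ∑ i, a i * Real.log (a i / b i)

/-- The ratio of the divergences after and before transmission through the channel `W`. -/
noncomputable def klRatio {ι κ : Type*} [Fintype ι] [Fintype κ]
    (W : Matrix κ ι ℝ) (pref p : ι → ℝ) : ℝ :=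
  kl (W.mulVec p) (W.mulVec pref) / kl p pref

/-- The contraction coefficient of the channel `W` with reference input pmf `pref`: the supremum
of the divergence ratio over all input pmfs `p ≠ pref`. -/
noncomputable def contractionCoeff {ι κ : Type*} [Fintype ι] [Fintype κ]
    (W : Matrix κ ι ℝ) (pref : ι → ℝ) : EReal :=
  ⨆ p : {p : ι → ℝ // p ∈ stdSimplex ℝ ι ∧ p ≠ pref}, (klRatio W pref p.1 : EReal)

/-- The column stochastic `3 × 3` transition matrix `W` of the channel. -/
noncomputable def channel (k : ℕ) : Matrix (Fin 3) (Fin 3) ℝ :=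
  !![1 - 2 * w1star k, 1 - 3 / 2 * w1star k, 1 - w1star k;
     2 * w1star k, w1star k, 0;
     0, 1 / 2 * w1star k, w1star k]

/-- The parameter domain; `w 0` and `w 1` stand for `w₁` and `w₂`. -/
def domain : Set (Fin 2 → ℝ) :=
  {w | (∀ i, w i ∈ Set.Icc (0 : ℝ) 1) ∧ 2 * w 0 - 1 ≤ w 1 ∧ w 1 ≤ w 0}

/-- The point `w* = (w₁*, w₂*)`. -/
noncomputable def wstar (k : ℕ) : Fin 2 → ℝ := ![w1star k, w2star k]

/-- The input pmf `p(w)`. -/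
def inPmf (w : Fin 2 → ℝ) : Fin 3 → ℝ := ![1 - 2 * w 0 + w 1, 2 * (w 0 - w 1), w 1]

/-- The output pmf `q(w) = W p(w)`. -/
noncomputable def outPmf (k : ℕ) (w : Fin 2 → ℝ) : Fin 3 → ℝ := (channel k).mulVec (inPmf w)

/-- The Contraction Coefficient Conjecture for `k`: the contraction coefficient of the channel `W`
with reference input `p* = p(w*)` is attained at `w = (1, 1)` and equals `H(w₁*) / (-ln w₂*)`. -/
def ContractionConjecture (k : ℕ) : Prop :=
  contractionCoeff (channel k) (inPmf (wstar k)) =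
      (klRatio (channel k) (inPmf (wstar k)) (inPmf ![1, 1]) : EReal) ∧
    contractionCoeff (channel k) (inPmf (wstar k)) =
      ((Real.binEntropy (w1star k) / (-Real.log (w2star k)) : ℝ) : EReal)

/-- `φ₂(w) = (d / k) D(P ‖ P*) - (d - 1) D(Q ‖ Q*)`. -/
noncomputable def phi2 (k d : ℕ) (w : Fin 2 → ℝ) : ℝ :=
  (d : ℝ) / k * kl (inPmf w) (inPmf (wstar k)) -
    ((d : ℝ) - 1) * kl (outPmf k w) (outPmf k (wstar k))

/-- The Hessian of `f` at `x`, the matrix of the second partial derivatives `∂ᵢ ∂ⱼ f (x)`. -/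
noncomputable def hessian {N : ℕ} (f : (Fin N → ℝ) → ℝ) (x : Fin N → ℝ) :
    Matrix (Fin N) (Fin N) ℝ :=
  Matrix.of fun i j =>
    lineDeriv ℝ (fun y => lineDeriv ℝ f y (Pi.single j 1)) x (Pi.single i 1)

/-- `√(2 / ((2π)² ∏ᵢ pᵢ(w*))) √((2π)² / det ((k / √(2d)) H))`, with `H` the Hessian of `φ₂`
at `w*`. -/
noncomputable def laplaceConstant (k d : ℕ) : ℝ :=
  √(2 / ((2 * Real.pi) ^ 2 * ∏ i, inPmf (wstar k) i)) *
    √((2 * Real.pi) ^ 2 / (((k : ℝ) / √(2 * d)) • hessian (phi2 k d) (wstar k)).det)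

end Occupation

/-!
The proof is the second moment method, in which the Laplace summation is carried out by dominated
convergence.

Counting the wirings that carry a given labelling of the variables to a given labelling of the
constraint half-edges (`card_equiv_comp_eq`, `sum_card_labellings`) writes `E[Z²]` as a sum over two
integers: the overlap `r` of the two solutions, and the number `s` of constraints on which both ones
are shared. All multinomial coefficients are conditioned Poisson probabilities
(`labelCount_mul_prod_pow`), so `E[Z²] / E[Z]²` is a double sum of products and quotients of Poisson
weights (`moment_two_div_sq`). By Stirling's formula the term at `(r, s)` has exponent
`-n φ₂(r / l, s / m)`, where `l = 2 n / k` is the number of ones of a solution.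

The assumption `d < d*` says that `(d - 1)` times the contraction coefficient is less than `d / k`
(`coefficient_lt`). Hence `φ₂` dominates a positive multiple of the divergence of the input laws
(`exists_mul_kl_le_phi2`), which is positive away from `w*`; this is the claim on the minimizer.
The divergence also dominates a squared distance, which bounds the terms by a Gaussian that is
uniform in `n`, `r` and `s` (`exists_overlapTerm_le_gaussian`). There is no polynomial loss at the
boundary of the domain, as only the weights of the three constraint types bring in square roots, and
a count far from its mean pays for them exponentially.

The Poisson local limit theorem (`tendsto_sqrt_mul_poissonWeight`) gives the pointwise limit of the
rescaled terms, a Gaussian density (`tendsto_mul_overlapTerm`). Comparing this limit with the uniform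
bound shows that the limiting quadratic form is positive definite, that is, `d < k`
(`lt_of_lt_dstar`). The sum is the integral of a step function, dominated convergence applies, and
the Gaussian integral has the value `√((k - 1) / (k - d))` (`tendsto_moment_ratio`). The Hessian is
computed by differentiating along lines (`hessian_phi2`), and the closed form of the constant is
algebra (`laplaceConstant_eq`).
-/

namespace Occupation

/-! ### Poisson weights -/

/-- The mass `e⁻ˡ lᵃ / a!` that the Poisson law with mean `l` gives to the integer `a`; it vanishes
for negative `a`. -/
noncomputable def poissonWeight (l : ℝ) (a : ℤ) : ℝ :=
  if 0 ≤ a then Real.exp (-l) * l ^ a.toNat / (a.toNat.factorial : ℝ) else 0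

/-- The large deviation cost `a ln (a / l) - a + l` of the value `a` under the Poisson law with
mean `l`. -/
noncomputable def poissonCost (l a : ℝ) : ℝ := a * Real.log (a / l) - a + l

lemma poissonWeight_natCast (l : ℝ) (a : ℕ) :
    poissonWeight l a = Real.exp (-l) * l ^ a / (a.factorial : ℝ) := by
  simp [poissonWeight]

lemma poissonWeight_of_neg (l : ℝ) {a : ℤ} (ha : a < 0) : poissonWeight l a = 0 := by
  simp [poissonWeight, not_le.mpr ha]

lemma poissonWeight_pos {l : ℝ} (hl : 0 < l) {a : ℤ} (ha : 0 ≤ a) : 0 < poissonWeight l a := by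
  rw [poissonWeight, if_pos ha]
  positivity

lemma poissonWeight_nonneg {l : ℝ} (hl : 0 < l) (a : ℤ) : 0 ≤ poissonWeight l a := by
  rw [poissonWeight]
  split_ifs <;> positivity

lemma le_factorial (a : ℕ) :
    √((a : ℝ) + 1) * ((a : ℝ) / Real.exp 1) ^ a ≤ (a.factorial : ℝ) := by
  rcases Nat.eq_zero_or_pos a with rfl | ha
  · simp
  refine le_trans ?_ (Stirling.le_factorial_stirling a)
  have h1 : (1 : ℝ) ≤ a := by exact_mod_cast ha
  gcongr
  nlinarith [Real.pi_gt_three]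

lemma factorial_le (a : ℕ) :
    (a.factorial : ℝ) ≤ Real.exp 1 * √((a : ℝ) + 1) * ((a : ℝ) / Real.exp 1) ^ a := by
  rcases Nat.eq_zero_or_pos a with rfl | ha
  · simp
  obtain ⟨b, rfl⟩ : ∃ b, a = b + 1 := ⟨a - 1, by omega⟩
  have h1 := Stirling.stirlingSeq'_antitone (Nat.zero_le b)
  simp only [Function.comp, Nat.succ_eq_add_one, zero_add, Stirling.stirlingSeq_one] at h1
  rw [Stirling.stirlingSeq, div_le_iff₀ (by positivity)] at h1
  refine h1.trans ?_
  rw [Real.sqrt_mul (by norm_num : (0 : ℝ) ≤ 2)]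
  have h2 : √(2 : ℝ) ≠ 0 := by positivity
  calc _ = Real.exp 1 * √(((b + 1 : ℕ) : ℝ)) * (((b + 1 : ℕ) : ℝ) / Real.exp 1) ^ (b + 1) := by
        field_simp
    _ ≤ _ := by gcongr; linarith

lemma exp_neg_mul_pow {l : ℝ} (hl : 0 < l) (a : ℕ) :
    Real.exp (-l) * l ^ a = Real.exp (-poissonCost l a) * ((a : ℝ) / Real.exp 1) ^ a := by
  rcases Nat.eq_zero_or_pos a with rfl | ha
  · simp [poissonCost]
  have h1 : (0 : ℝ) < a := by exact_mod_cast ha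
  have h2 : ((a : ℝ) / Real.exp 1) ^ a = l ^ a * Real.exp (a * Real.log (a / l) - a) := by
    rw [Real.exp_sub, Real.exp_nat_mul, Real.exp_log (by positivity), ← Real.exp_one_pow,
      ← div_pow, ← mul_pow]
    congr 1
    field_simp
  rw [h2, mul_left_comm, ← Real.exp_add, mul_comm]
  congr 2
  unfold poissonCost
  ring

lemma poissonWeight_le {l : ℝ} (hl : 0 < l) {a : ℤ} (ha : 0 ≤ a) :
    poissonWeight l a ≤ Real.exp (-poissonCost l a) / √((a : ℝ) + 1) := by
  lift a to ℕ using ha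
  rw [poissonWeight_natCast, exp_neg_mul_pow hl, Int.cast_natCast,
    div_le_div_iff₀ (by positivity) (by positivity), mul_assoc]
  gcongr
  rw [mul_comm]
  exact le_factorial a

lemma le_poissonWeight {l : ℝ} (hl : 0 < l) {a : ℤ} (ha : 0 ≤ a) :
    Real.exp (-poissonCost l a) / (Real.exp 1 * √((a : ℝ) + 1)) ≤ poissonWeight l a := by
  lift a to ℕ using ha
  rw [poissonWeight_natCast, exp_neg_mul_pow hl, Int.cast_natCast,
    div_le_div_iff₀ (by positivity) (by positivity), mul_assoc]
  gcongr
  rw [mul_comm]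
  exact factorial_le a

lemma poissonCost_self {l : ℝ} (hl : 0 < l) : poissonCost l l = 0 := by
  simp [poissonCost, div_self hl.ne']

lemma poissonCost_mul {c : ℝ} (hc : 0 < c) (l a : ℝ) :
    poissonCost (c * l) (c * a) = c * poissonCost l a := by
  rw [poissonCost, poissonCost, mul_div_mul_left _ _ hc.ne']
  ring

lemma sq_sqrt_sub_le_poissonCost {l a : ℝ} (hl : 0 < l) (ha : 0 ≤ a) :
    (√a - √l) ^ 2 ≤ poissonCost l a := by
  rcases ha.eq_or_lt with rfl | ha
  · simp [poissonCost, Real.sq_sqrt hl.le]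
  have h1 : Real.log (a / l) = -(2 * Real.log (√l / √a)) := by
    rw [Real.log_div (by positivity) (by positivity), Real.log_div (by positivity) (by positivity),
      Real.log_sqrt hl.le, Real.log_sqrt ha.le]
    ring
  have h2 := Real.log_le_sub_one_of_pos (show 0 < √l / √a by positivity)
  have h3 : a * (√l / √a) = √a * √l := by
    nth_rw 1 [← Real.mul_self_sqrt ha.le]
    field_simp
  have h4 : a * Real.log (√l / √a) ≤ √a * √l - a := by
    calc _ ≤ a * (√l / √a - 1) := by gcongr
      _ = _ := by rw [mul_sub, h3, mul_one]
  rw [poissonCost, h1, sub_sq, Real.sq_sqrt ha.le, Real.sq_sqrt hl.le]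
  nlinarith

/-- The ratio of the Poisson weights before and after scaling by `d`, bounded from above. -/
lemma poissonWeight_div_le {l : ℝ} (hl : 0 < l) {d : ℕ} (hd : 0 < d) {a : ℤ} (ha : 0 ≤ a) :
    poissonWeight l a / poissonWeight (d * l) (d * a) ≤
      Real.exp 1 * √d * Real.exp (((d : ℝ) - 1) * poissonCost l a) := by
  have hd1 : (1 : ℝ) ≤ d := by exact_mod_cast hd
  have hl' : 0 < (d : ℝ) * l := by positivity
  have ha' : (0 : ℤ) ≤ d * a := by positivity
  have ha2 : (0 : ℝ) ≤ a := by exact_mod_cast ha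
  rw [div_le_iff₀ (poissonWeight_pos hl' ha')]
  refine (poissonWeight_le hl ha).trans ?_
  refine le_trans ?_ (mul_le_mul_of_nonneg_left (le_poissonWeight hl' ha') (by positivity))
  have hcast : (((d : ℤ) * a : ℤ) : ℝ) = d * a := by push_cast; rfl
  rw [hcast, poissonCost_mul (by positivity),
    show -poissonCost l a = (d - 1) * poissonCost l a + -(d * poissonCost l a) by ring,
    Real.exp_add]
  have h3 : √((d : ℝ) * a + 1) ≤ √d * √((a : ℝ) + 1) := by
    rw [← Real.sqrt_mul (by positivity)]
    apply Real.sqrt_le_sqrt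
    nlinarith
  rw [mul_div_assoc', div_le_div_iff₀ (by positivity) (by positivity)]
  calc _ ≤ Real.exp ((d - 1) * poissonCost l a) * Real.exp (-(d * poissonCost l a)) *
        (Real.exp 1 * (√d * √((a : ℝ) + 1))) := by gcongr
    _ = _ := by ring

/-- Companion of `poissonWeight_div_le` at the mean, where the cost vanishes. -/
lemma poissonWeight_mul_div_le {d a : ℕ} (hd : 0 < d) (ha : 0 < a) :
    poissonWeight (d * a) (d * a) / poissonWeight a a ≤ Real.exp 1 := by
  have hd1 : (1 : ℝ) ≤ d := by exact_mod_cast hd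
  have ha1 : (0 : ℝ) < a := by exact_mod_cast ha
  have hl' : 0 < (d : ℝ) * a := by positivity
  have h1 := poissonWeight_le hl' (a := (d * a : ℤ)) (by positivity)
  have h2 := le_poissonWeight ha1 (a := (a : ℤ)) (by positivity)
  push_cast at h1 h2
  rw [poissonCost_self hl'] at h1
  rw [poissonCost_self ha1] at h2
  rw [div_le_iff₀ (poissonWeight_pos ha1 (by positivity))]
  refine h1.trans (le_trans ?_ (mul_le_mul_of_nonneg_left h2 (by positivity)))
  rw [mul_div_assoc', mul_div_mul_left _ _ (Real.exp_pos 1).ne']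
  gcongr
  nlinarith

/-! ### The local limit theorem for Poisson weights -/

lemma abs_one_add_mul_log_sub_le {t : ℝ} (ht : |t| ≤ 1 / 2) :
    |(1 + t) * Real.log (1 + t) - t - t ^ 2 / 2| ≤ 4 * |t| ^ 3 := by
  have h1 := Real.abs_log_sub_add_sum_range_le (x := -t) (by rw [abs_neg]; linarith) 2
  simp only [Finset.sum_range_succ, Finset.sum_range_zero, abs_neg, sub_neg_eq_add] at h1
  have h2 : |t| ^ (2 + 1) / (1 - |t|) ≤ 2 * |t| ^ 3 := by
    rw [div_le_iff₀ (by linarith)]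
    have h : 0 ≤ |t| ^ 3 := by positivity
    have h' := mul_nonneg h (sub_nonneg.mpr ht)
    norm_num
    linarith
  have h3 := h1.trans h2
  set R := (0 + (-t) ^ (0 + 1) / ((0 : ℕ) + 1 : ℝ) + (-t) ^ (1 + 1) / ((1 : ℕ) + 1 : ℝ)) +
    Real.log (1 + t) with hR
  have h4 : (1 + t) * Real.log (1 + t) - t - t ^ 2 / 2 = (1 + t) * R - t ^ 3 / 2 := by
    rw [hR]; push_cast; ring
  have h5 : |1 + t| ≤ 3 / 2 := by
    rw [abs_le] at *; constructor <;> linarith [ht.1, ht.2]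
  rw [h4]
  calc _ ≤ |(1 + t) * R| + |t ^ 3 / 2| := abs_sub _ _
    _ = |1 + t| * |R| + |t| ^ 3 / 2 := by rw [abs_mul, abs_div, abs_pow]; norm_num
    _ ≤ 3 / 2 * (2 * |t| ^ 3) + |t| ^ 3 / 2 := by gcongr
    _ ≤ _ := by nlinarith [show 0 ≤ |t| ^ 3 by positivity]

section LocalLimit

variable {ι : Type*} {F : Filter ι} {l : ι → ℝ} {a : ι → ℤ} {x : ℝ}

lemma tendsto_deviation_div (hl : Tendsto l F atTop)
    (hx : Tendsto (fun i => ((a i : ℝ) - l i) / √(l i)) F (𝓝 x)) :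
    Tendsto (fun i => ((a i : ℝ) - l i) / l i) F (𝓝 0) := by
  have h1 : Tendsto (fun i => (√(l i))⁻¹) F (𝓝 0) :=
    (Real.tendsto_sqrt_atTop.comp hl).inv_tendsto_atTop
  have h2 := hx.mul h1
  rw [mul_zero] at h2
  refine h2.congr' ?_
  filter_upwards [hl.eventually_gt_atTop 0] with i hi
  rw [← div_eq_mul_inv, div_div, Real.mul_self_sqrt hi.le]

lemma tendsto_poissonCost (hl : Tendsto l F atTop)
    (hx : Tendsto (fun i => ((a i : ℝ) - l i) / √(l i)) F (𝓝 x)) :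
    Tendsto (fun i => poissonCost (l i) (a i)) F (𝓝 (x ^ 2 / 2)) := by
  have ht := tendsto_deviation_div hl hx
  have h1 : Tendsto (fun i => (((a i : ℝ) - l i) / √(l i)) ^ 2 / 2) F (𝓝 (x ^ 2 / 2)) :=
    (hx.pow 2).div_const 2
  have h2 : Tendsto (fun i => 4 * (|((a i : ℝ) - l i) / √(l i)| ^ 2 * |((a i : ℝ) - l i) / l i|))
      F (𝓝 0) := by
    have := ((hx.abs.pow 2).mul ht.abs).const_mul 4
    simpa using this
  have h3 : Tendsto (fun i => poissonCost (l i) (a i) - (((a i : ℝ) - l i) / √(l i)) ^ 2 / 2) F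
      (𝓝 0) := by
    refine squeeze_zero_norm' ?_ h2
    have ht' : ∀ᶠ i in F, |((a i : ℝ) - l i) / l i| ≤ 1 / 2 := by
      have := ht.abs
      rw [abs_zero] at this
      exact this.eventually (ge_mem_nhds (by norm_num))
    filter_upwards [hl.eventually_gt_atTop 0, ht'] with i hi hti
    have h4 := abs_one_add_mul_log_sub_le hti
    set t := ((a i : ℝ) - l i) / l i with htdef
    have h5 : (a i : ℝ) = l i * (1 + t) := by rw [htdef]; field_simp; ring
    have h6 : ((a i : ℝ) - l i) / √(l i) = √(l i) * t := by
      rw [div_eq_iff (by positivity), h5]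
      linear_combination -t * Real.mul_self_sqrt hi.le
    have h7 : poissonCost (l i) (a i) - (√(l i) * t) ^ 2 / 2 =
        l i * ((1 + t) * Real.log (1 + t) - t - t ^ 2 / 2) := by
      rw [poissonCost, h5, mul_div_cancel_left₀ _ hi.ne', mul_pow, Real.sq_sqrt hi.le]
      ring
    rw [Real.norm_eq_abs, h6, h7, abs_mul, abs_of_pos hi, abs_mul, mul_pow,
      abs_of_pos (Real.sqrt_pos.mpr hi), Real.sq_sqrt hi.le]
    calc _ ≤ l i * (4 * |t| ^ 3) := by gcongr
      _ = _ := by ring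
  simpa using h3.add h1

/-- The local limit theorem: `√l P(a) → e^(-x² / 2) / √(2π)` for the Poisson weights `P` with mean
`l → ∞`, when `(a - l) / √l → x`. -/
theorem tendsto_sqrt_mul_poissonWeight (hl : Tendsto l F atTop)
    (hx : Tendsto (fun i => ((a i : ℝ) - l i) / √(l i)) F (𝓝 x)) :
    Tendsto (fun i => √(l i) * poissonWeight (l i) (a i)) F
      (𝓝 (Real.exp (-(x ^ 2 / 2)) / √(2 * Real.pi))) := by
  have ht := tendsto_deviation_div hl hx
  have hal : Tendsto (fun i => (a i : ℝ) / l i) F (𝓝 1) := by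
    have : Tendsto (fun i => ((a i : ℝ) - l i) / l i + 1) F (𝓝 (0 + 1)) := ht.add_const 1
    rw [zero_add] at this
    refine this.congr' ?_
    filter_upwards [hl.eventually_gt_atTop 0] with i hi
    field_simp
    ring
  have ha : Tendsto (fun i => (a i : ℝ)) F atTop := by
    refine (hl.atTop_mul_pos one_pos hal).congr' ?_
    filter_upwards [hl.eventually_gt_atTop 0] with i hi
    field_simp
  have ha' : Tendsto (fun i => (a i).toNat) F atTop := by
    refine (tendsto_natCast_atTop_iff (R := ℝ)).mp (ha.congr' ?_)
    filter_upwards [ha.eventually_ge_atTop 0] with i hi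
    have : 0 ≤ a i := by exact_mod_cast hi
    exact_mod_cast congrArg (Int.cast : ℤ → ℝ) (Int.toNat_of_nonneg this).symm
  have hs := Stirling.tendsto_stirlingSeq_sqrt_pi.comp ha'
  have hc := (Real.continuous_exp.tendsto _).comp (tendsto_poissonCost hl hx).neg
  have hr : Tendsto (fun i => (√(2 * ((a i : ℝ) / l i)))⁻¹) F (𝓝 (√(2 * 1))⁻¹) :=
    ((Real.continuous_sqrt.tendsto _).comp (hal.const_mul 2)).inv₀ (by positivity)
  have hmain := (hc.mul hr).div hs (by positivity)
  have hlim : Real.exp (-(x ^ 2 / 2)) * (√(2 * 1))⁻¹ / √Real.pi =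
      Real.exp (-(x ^ 2 / 2)) / √(2 * Real.pi) := by
    rw [mul_one, Real.sqrt_mul (by norm_num : (0 : ℝ) ≤ 2)]
    field_simp
  rw [hlim] at hmain
  refine hmain.congr' ?_
  filter_upwards [hl.eventually_gt_atTop 0, ha.eventually_gt_atTop 0] with i hi hai
  have hai' : 0 < a i := by exact_mod_cast hai
  obtain ⟨b, hb⟩ : ∃ b : ℕ, a i = b := ⟨(a i).toNat, (Int.toNat_of_nonneg hai'.le).symm⟩
  simp only [Pi.div_apply, Function.comp_apply, hb, Int.toNat_natCast, Int.cast_natCast]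
  have hb0 : (0 : ℝ) < b := by rw [hb] at hai; exact_mod_cast hai
  rw [poissonWeight_natCast, exp_neg_mul_pow hi, Stirling.stirlingSeq, mul_div_assoc',
    Real.sqrt_div (by positivity)]
  have h1 : 0 < √(2 * (b : ℝ)) := by positivity
  have h2 : (0 : ℝ) < b.factorial := by positivity
  have h3 : 0 < √(l i) := by positivity
  field_simp

end LocalLimit

/-! ### Counting functions and wirings by their fibre sizes -/

/-- The number of points that `f` sends to `c`. -/
noncomputable def fiberCard {A C : Type*} (f : A → C) (c : C) : ℕ := Nat.card {a // f a = c}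

section Fibers

variable {A B C : Type*}

lemma fiberCard_eq_card_filter [Fintype A] [DecidableEq C] (f : A → C) (c : C) :
    fiberCard f c = (Finset.univ.filter (fun a => f a = c)).card := by
  rw [fiberCard, Nat.card_eq_fintype_card, Fintype.card_subtype]

lemma sum_fiberCard [Fintype A] [Fintype C] (f : A → C) : ∑ c, fiberCard f c = Fintype.card A := by
  classical
  simp only [fiberCard_eq_card_filter]
  exact (Finset.card_eq_sum_card_fiberwise (fun _ _ => Finset.mem_univ _)).symm

lemma fiberCard_comp_equiv (f : A → C) (e : B ≃ A) (c : C) :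
    fiberCard (f ∘ e) c = fiberCard f c :=
  Nat.card_congr (e.subtypeEquiv fun _ => Iff.rfl)

lemma fiberCard_comp_fst [Fintype B] (f : A → C) (c : C) :
    fiberCard (fun p : A × B => f p.1) c = Fintype.card B * fiberCard f c := by
  rw [fiberCard, fiberCard, mul_comm, ← Nat.card_eq_fintype_card, ← Nat.card_prod]
  exact Nat.card_congr
    { toFun := fun p => (⟨p.1.1, p.2⟩, p.1.2)
      invFun := fun p => ⟨(p.1.1, p.2), p.1.2⟩
      left_inv := fun _ => rfl
      right_inv := fun _ => rfl }

lemma fiberCard_uncurry [Fintype A] [Fintype B] (M : A → B → C) (c : C) :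
    fiberCard (fun p : A × B => M p.1 p.2) c = ∑ a, fiberCard (M a) c := by
  simp only [fiberCard]
  rw [← Nat.card_sigma]
  exact Nat.card_congr
    { toFun := fun p => ⟨p.1.1, p.1.2, p.2⟩
      invFun := fun p => ⟨(p.1, p.2.1), p.2.2⟩
      left_inv := fun _ => rfl
      right_inv := fun _ => rfl }

lemma prod_comp_eq_prod_pow_fiberCard [Fintype A] [Fintype C] {R : Type*} [CommMonoid R]
    (f : A → C) (φ : C → R) :
    ∏ a, φ (f a) = ∏ c, φ c ^ fiberCard f c := by
  classical
  simp only [fiberCard_eq_card_filter]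
  rw [← Finset.prod_fiberwise_of_maps_to (s := Finset.univ) (t := Finset.univ) (g := f)
    (fun _ _ => Finset.mem_univ _)]
  refine Finset.prod_congr rfl fun c _ => ?_
  rw [Finset.prod_congr rfl (g := fun _ => φ c), Finset.prod_const]
  intro a ha
  rw [(Finset.mem_filter.mp ha).2]

lemma sum_comp_eq_sum_fiberCard_mul [Fintype A] [Fintype C] {R : Type*} [Semiring R]
    (f : A → C) (φ : C → R) : ∑ a, φ (f a) = ∑ c, fiberCard f c * φ c := by
  classical
  simp only [fiberCard_eq_card_filter]
  rw [← Finset.sum_fiberwise_of_maps_to (s := Finset.univ) (t := Finset.univ) (g := f)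
    (fun _ _ => Finset.mem_univ _)]
  refine Finset.sum_congr rfl fun c _ => ?_
  rw [Finset.sum_congr rfl (g := fun _ => φ c), Finset.sum_const, nsmul_eq_mul]
  intro a ha
  rw [(Finset.mem_filter.mp ha).2]

/-- The number of bijections that carry one labelling to another one with the same fibre sizes:
they form a torsor of the stabilizer of the labelling. -/
lemma card_equiv_comp_eq [Fintype A] [Fintype B] [Fintype C] (L : A → C) (M : B → C)
    (h : ∀ c, fiberCard L c = fiberCard M c) :
    Nat.card {g : A ≃ B // M ∘ g = L} = ∏ c, (fiberCard L c).factorial := by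
  classical
  let e : ∀ c, {a // L a = c} ≃ {b // M b = c} := fun c => Fintype.equivOfCardEq
    (by simpa [fiberCard, Nat.card_eq_fintype_card] using h c)
  have h₀ : ∀ a, M (Equiv.ofFiberEquiv e a) = L a := Equiv.ofFiberEquiv_map e
  generalize Equiv.ofFiberEquiv e = g₀ at h₀
  have h₁ : ∀ b, L (g₀.symm b) = M b := fun b => by
    rw [← h₀, Equiv.apply_symm_apply]
  have e' : {g : A ≃ B // M ∘ g = L} ≃ {σ : Equiv.Perm A // L ∘ σ = L} :=
    { toFun := fun g => ⟨g.1.trans g₀.symm, by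
        funext a; simpa [h₁] using congrFun g.2 a⟩
      invFun := fun σ => ⟨σ.1.trans g₀, by
        funext a; simpa [h₀] using congrFun σ.2 a⟩
      left_inv := fun g => by ext; simp
      right_inv := fun σ => by ext; simp }
  rw [Nat.card_congr e', Nat.card_eq_fintype_card, DomMulAct.stabilizer_card]
  exact Finset.prod_congr rfl fun c _ => by rw [fiberCard, Nat.card_eq_fintype_card]

lemma exists_fiberCard_eq [Fintype A] [Fintype C] (v : C → ℕ) (hv : ∑ c, v c = Fintype.card A) :
    ∃ f : A → C, ∀ c, fiberCard f c = v c := by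
  have e : (Σ c, Fin (v c)) ≃ A := Fintype.equivOfCardEq (by simp [hv])
  refine ⟨Sigma.fst ∘ e.symm, fun c => ?_⟩
  rw [fiberCard_comp_equiv, fiberCard]
  have : {p : Σ c, Fin (v c) // p.1 = c} ≃ Fin (v c) :=
    { toFun := fun p => p.2 ▸ p.1.2
      invFun := fun i => ⟨⟨c, i⟩, rfl⟩
      left_inv := by rintro ⟨⟨c, i⟩, rfl⟩; rfl
      right_inv := fun _ => rfl }
  rw [Nat.card_congr this, Nat.card_eq_fintype_card, Fintype.card_fin]

/-- The multinomial count of the functions with prescribed fibre sizes. -/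
lemma card_fiberCard_eq_mul [Fintype A] [Fintype C] (v : C → ℕ)
    (hv : ∑ c, v c = Fintype.card A) :
    Nat.card {f : A → C // ∀ c, fiberCard f c = v c} * ∏ c, (v c).factorial =
      (Fintype.card A).factorial := by
  classical
  obtain ⟨f₀, h₀⟩ := exists_fiberCard_eq v hv
  have h1 : Nat.card (Σ f : {f : A → C // ∀ c, fiberCard f c = v c},
      {g : A ≃ A // f₀ ∘ g = f.1}) = Nat.card (A ≃ A) :=
    Nat.card_congr
      { toFun := fun p => p.2.1
        invFun := fun g => ⟨⟨f₀ ∘ g, fun c => by rw [fiberCard_comp_equiv, h₀]⟩, ⟨g, rfl⟩⟩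
        left_inv := by rintro ⟨⟨f, hf⟩, ⟨g, hg⟩⟩; dsimp only at hg; subst hg; rfl
        right_inv := fun _ => rfl }
  rw [Nat.card_sigma, Nat.card_eq_fintype_card (α := A ≃ A), Fintype.card_perm] at h1
  rw [← h1, Finset.sum_congr rfl (g := fun _ => ∏ c, (v c).factorial), Finset.sum_const,
    Finset.card_univ, Nat.card_eq_fintype_card, smul_eq_mul]
  intro f _
  rw [card_equiv_comp_eq _ _ fun c => by rw [f.2, h₀]]
  exact Finset.prod_congr rfl fun c _ => by rw [f.2]

end Fibers

section Wirings

variable {C T : Type*} {k d n m : ℕ}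

/-- The number of labellings of `N` points with the prescribed label counts `v`, which are integers
so that a count that would be negative gives zero. -/
noncomputable def labelCount (N : ℕ) (v : C → ℤ) : ℕ :=
  Nat.card {f : Fin N → C // ∀ c, (fiberCard f c : ℤ) = v c}

lemma labelCount_of_neg (N : ℕ) {v : C → ℤ} {c : C} (hc : v c < 0) : labelCount N v = 0 := by
  rw [labelCount, Nat.card_eq_zero]
  left
  refine ⟨fun f => ?_⟩
  have := f.2 c
  omega

lemma labelCount_mul_prod_factorial [Fintype C] {N : ℕ} {v : C → ℕ} (hv : ∑ c, v c = N) :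
    labelCount N (fun c => (v c : ℤ)) * ∏ c, (v c).factorial = N.factorial := by
  have h := card_fiberCard_eq_mul (A := Fin N) v (by rw [hv, Fintype.card_fin])
  rw [Fintype.card_fin] at h
  simpa [labelCount] using h

lemma labelCount_mul_prod_toNat_factorial [Fintype C] {N : ℕ} {v : C → ℤ} (h : ∀ c, 0 ≤ v c)
    (hv : ∑ c, v c = N) : labelCount N v * ∏ c, (v c).toNat.factorial = N.factorial := by
  lift v to C → ℕ using h
  beta_reduce at hv
  exact labelCount_mul_prod_factorial (by exact_mod_cast hv)

/-- Multinomial probabilities are Poisson probabilities conditioned on the sum. -/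
lemma labelCount_mul_prod_pow [Fintype C] {N : ℕ} (hN : 0 < N) {v : C → ℤ} (hv : ∑ c, v c = N)
    {p : C → ℝ} (hp : ∑ c, p c = 1) :
    (labelCount N v : ℝ) * ∏ c, p c ^ (v c).toNat =
      (∏ c, poissonWeight (N * p c) (v c)) / poissonWeight N N := by
  by_cases h : ∀ c, 0 ≤ v c
  · lift v to C → ℕ using h
    have hv' : ∑ c, v c = N := by
      beta_reduce at hv
      exact_mod_cast hv
    have h1 : (labelCount N (fun c => (v c : ℤ)) : ℝ) * ∏ c, ((v c).factorial : ℝ) =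
        N.factorial := by exact_mod_cast labelCount_mul_prod_factorial hv'
    have h2 : ∏ c, ((v c).factorial : ℝ) ≠ 0 :=
      Finset.prod_ne_zero_iff.mpr fun c _ => by positivity
    have hN' : (N : ℝ) ≠ 0 := by positivity
    rw [← eq_div_iff h2] at h1
    simp only [poissonWeight_natCast, Int.toNat_natCast]
    rw [h1, Finset.prod_div_distrib, Finset.prod_mul_distrib, ← Real.exp_sum,
      Finset.sum_neg_distrib, ← Finset.mul_sum, hp, mul_one]
    simp only [mul_pow]
    rw [Finset.prod_mul_distrib, Finset.prod_pow_eq_pow_sum, hv']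
    have h3 := Real.exp_ne_zero (-(N : ℝ))
    have h4 : (N.factorial : ℝ) ≠ 0 := by positivity
    field_simp
  · push Not at h
    obtain ⟨c, hc⟩ := h
    rw [labelCount_of_neg N hc, Finset.prod_eq_zero (f := fun c => poissonWeight _ (v c))
      (Finset.mem_univ c) (poissonWeight_of_neg _ hc)]
    simp

open Classical in
/-- Pairs of a wiring and a labelling of the variables that induce at each constraint label counts
of the form `u t`, counted by first fixing the labelling `f`, the types `τ` of the constraints and
the labels of the constraint half-edges. -/
lemma sum_card_labellings [Fintype C] [Fintype T] (u : T → C → ℤ) (hu : Function.Injective u) :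
    ∑ g : Configuration k d n m, Nat.card {f : Fin n → C //
        ∀ a, ∃ t, ∀ c, (fiberCard (fun h => f (g.symm (a, h)).1) c : ℤ) = u t c} =
      ∑ f : Fin n → C, ∑ τ : Fin m → T,
        if ∀ c, (d * fiberCard f c : ℤ) = ∑ a, u (τ a) c then
          (∏ a, labelCount k (u (τ a))) * ∏ c, (d * fiberCard f c).factorial else 0 := by
  have h1 : Nat.card (Σ g : Configuration k d n m, {f : Fin n → C //
        ∀ a, ∃ t, ∀ c, (fiberCard (fun h => f (g.symm (a, h)).1) c : ℤ) = u t c}) =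
      Nat.card (Σ f : Fin n → C, Σ τ : Fin m → T,
        Σ M : ((a : Fin m) → {v : Fin k → C // ∀ c, (fiberCard v c : ℤ) = u (τ a) c}),
          {g : Configuration k d n m // (fun p => (M p.1).1 p.2) ∘ g = fun p => f p.1}) := by
    have hM : ∀ (f : Fin n → C) (M : Fin m → Fin k → C) (g : Configuration k d n m),
        ((fun p => M p.1 p.2) ∘ g = fun p => f p.1) →
        ∀ a, M a = fun h => f (g.symm (a, h)).1 := fun f M g hg a => by
      funext h
      simpa using congrFun hg (g.symm (a, h))
    symm
    refine Nat.card_congr (Equiv.ofBijective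
      (fun p => ⟨p.2.2.2.1, p.1, fun a => ⟨p.2.1 a, fun c => ?_⟩⟩) ⟨?_, ?_⟩)
    · rw [← hM p.1 (fun a => (p.2.2.1 a).1) p.2.2.2.1 p.2.2.2.2 a]
      exact (p.2.2.1 a).2 c
    · rintro ⟨f, τ, M, g, hg⟩ ⟨f', τ', M', g', hg'⟩ h
      simp only [Sigma.mk.injEq] at h
      obtain ⟨rfl, h⟩ := h
      obtain rfl : f = f' := by simpa using h
      have hMM : ∀ a, (M a).1 = (M' a).1 := fun a =>
        (hM f (fun a => (M a).1) g hg a).trans (hM f (fun a => (M' a).1) g hg' a).symm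
      obtain rfl : τ = τ' := funext fun a => hu <| funext fun c => by
        rw [← (M a).2 c, ← (M' a).2 c, hMM a]
      obtain rfl : M = M' := funext fun a => Subtype.ext (hMM a)
      rfl
    · rintro ⟨g, f, hf⟩
      choose τ hτ using id hf
      exact ⟨⟨f, τ, fun a => ⟨fun h => f (g.symm (a, h)).1, hτ a⟩, g, by funext q; simp⟩, rfl⟩
  simp only [Nat.card_sigma] at h1
  rw [h1]
  refine Finset.sum_congr rfl fun f _ => Finset.sum_congr rfl fun τ _ => ?_
  have h2 : ∀ M : ((a : Fin m) → {v : Fin k → C // ∀ c, (fiberCard v c : ℤ) = u (τ a) c}), ∀ c,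
      (fiberCard (fun p : Fin m × Fin k => (M p.1).1 p.2) c : ℤ) = ∑ a, u (τ a) c := fun M c => by
    rw [fiberCard_uncurry fun a => (M a).1, Nat.cast_sum]
    exact Finset.sum_congr rfl fun a _ => (M a).2 c
  have h3 : ∀ c, fiberCard (fun p : Fin n × Fin d => f p.1) c = d * fiberCard f c := fun c => by
    rw [fiberCard_comp_fst, Fintype.card_fin]
  split_ifs with h
  · have h4 : ∀ M : ((a : Fin m) → {v : Fin k → C // ∀ c, (fiberCard v c : ℤ) = u (τ a) c}),
        Nat.card {g : Configuration k d n m // (fun p => (M p.1).1 p.2) ∘ g = fun p => f p.1} =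
          ∏ c, (d * fiberCard f c).factorial := fun M => by
      rw [card_equiv_comp_eq _ _ fun c => by
        zify; rw [h2, h3, Nat.cast_mul, h]]
      exact Finset.prod_congr rfl fun c _ => by rw [h3]
    rw [Finset.sum_congr rfl fun M _ => h4 M, Finset.sum_const, Finset.card_univ, smul_eq_mul,
      ← Nat.card_eq_fintype_card, Nat.card_pi]
    rfl
  · refine Finset.sum_eq_zero fun M _ => ?_
    rw [Nat.card_eq_zero]
    left
    refine ⟨fun g => h fun c => ?_⟩
    rw [← h2 M c, ← Nat.cast_mul, ← h3 c, ← g.2, fiberCard_comp_equiv]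

end Wirings

/-! ### The first two moments -/

/-- The label counts on `N` points, `l` of them with value one. -/
def valueCount (N l : ℤ) : Bool → ℤ := fun c => bif c then l else N - l

/-- The label counts for a pair of assignments of `N` points: each assignment has `l` ones, and `r`
of them are common. -/
def overlapCount (N l r : ℤ) : Bool × Bool → ℤ :=
  fun c => bif c.1 then (bif c.2 then r else l - r) else (bif c.2 then l - r else N + r - 2 * l)

/-- The numbers of constraints, out of `m`, with overlap `0`, `1` and `2`, when the total overlap
is `S` and `s` constraints have overlap `2`. -/
def typeCount (m S s : ℤ) : Fin 3 → ℤ := ![m + s - S, S - 2 * s, s]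

lemma sum_valueCount (N l : ℤ) : ∑ c, valueCount N l c = N := by
  simp [valueCount]

lemma sum_overlapCount (N l r : ℤ) : ∑ c, overlapCount N l r c = N := by
  simp [overlapCount, Fintype.sum_prod_type]
  ring

lemma sum_typeCount (m S s : ℤ) : ∑ t, typeCount m S s t = m := by
  simp [typeCount, Fin.sum_univ_three]
  ring

lemma fiberCard_true_eq_iff {k : ℕ} (v : Fin k → Bool) :
    Nat.card {h : Fin k // v h = true} = 2 ↔ ∀ c, (fiberCard v c : ℤ) = valueCount k 2 c := by
  have h := sum_fiberCard v
  simp only [Fintype.sum_bool, Fintype.card_fin] at h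
  change fiberCard v true = 2 ↔ _
  simp only [Bool.forall_bool, valueCount, cond_true, cond_false]
  omega

lemma fiberCard_fst {A : Type*} [Fintype A] (v : A → Bool × Bool) (b : Bool) :
    fiberCard (fun h => (v h).1) b = fiberCard v (b, true) + fiberCard v (b, false) := by
  classical
  simp only [fiberCard_eq_card_filter]
  rw [← Finset.card_union_of_disjoint]
  · congr 1
    ext a
    simp only [Finset.mem_filter, Finset.mem_union, Finset.mem_univ, true_and, Prod.ext_iff]
    cases (v a).2 <;> simp
  · rw [Finset.disjoint_filter]
    intro a _ h h'
    simp [h] at h'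

lemma fiberCard_snd {A : Type*} [Fintype A] (v : A → Bool × Bool) (b : Bool) :
    fiberCard (fun h => (v h).2) b = fiberCard v (true, b) + fiberCard v (false, b) := by
  classical
  simp only [fiberCard_eq_card_filter]
  rw [← Finset.card_union_of_disjoint]
  · congr 1
    ext a
    simp only [Finset.mem_filter, Finset.mem_union, Finset.mem_univ, true_and, Prod.ext_iff]
    cases (v a).1 <;> simp
  · rw [Finset.disjoint_filter]
    intro a _ h h'
    simp [h] at h'

lemma forall_bool_prod {p : Bool × Bool → Prop} :
    (∀ c, p c) ↔ p (true, true) ∧ p (true, false) ∧ p (false, true) ∧ p (false, false) := by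
  simp only [Prod.forall, Bool.forall_bool]
  tauto

/-- Both assignments have exactly two ones among the `k` points iff the overlap is `0`, `1` or `2`
and determines the label counts. -/
lemma fiberCard_pair_eq_iff {k : ℕ} (v : Fin k → Bool × Bool) :
    (Nat.card {h : Fin k // (v h).1 = true} = 2 ∧ Nat.card {h : Fin k // (v h).2 = true} = 2) ↔
      ∃ t : Fin 3, ∀ c, (fiberCard v c : ℤ) = overlapCount k 2 (t : ℕ) c := by
  have h := sum_fiberCard v
  simp only [Fintype.sum_prod_type, Fintype.sum_bool, Fintype.card_fin] at h
  change fiberCard (fun h => (v h).1) true = 2 ∧ fiberCard (fun h => (v h).2) true = 2 ↔ _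
  rw [fiberCard_fst, fiberCard_snd]
  simp only [forall_bool_prod, overlapCount, cond_true, cond_false]
  constructor
  · rintro ⟨h1, h2⟩
    refine ⟨⟨fiberCard v (true, true), by omega⟩, ?_⟩
    dsimp only
    refine ⟨rfl, ?_, ?_, ?_⟩ <;> omega
  · rintro ⟨t, ht⟩
    omega

lemma numSolutions_eq {k d n m : ℕ} (g : Configuration k d n m) :
    numSolutions g = Nat.card {f : Fin n → Bool //
      ∀ a, ∃ t : Unit, ∀ c, (fiberCard (fun h => f (g.symm (a, h)).1) c : ℤ) =
        (fun _ : Unit => valueCount k 2) t c} := by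
  refine Nat.card_congr (Equiv.subtypeEquivRight fun f => forall_congr' fun a => ?_)
  rw [fiberCard_true_eq_iff fun h => f (g.symm (a, h)).1]
  simp

lemma numSolutions_sq_eq {k d n m : ℕ} (g : Configuration k d n m) :
    numSolutions g ^ 2 = Nat.card {f : Fin n → Bool × Bool //
      ∀ a, ∃ t : Fin 3, ∀ c, (fiberCard (fun h => f (g.symm (a, h)).1) c : ℤ) =
        (fun t : Fin 3 => overlapCount k 2 (t : ℕ)) t c} := by
  rw [sq, numSolutions, ← Nat.card_prod]
  refine Nat.card_congr
    { toFun := fun p => ⟨fun i => (p.1.1 i, p.2.1 i), fun a =>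
        (fiberCard_pair_eq_iff fun h => (p.1.1 (g.symm (a, h)).1, p.2.1 (g.symm (a, h)).1)).mp
          ⟨p.1.2 a, p.2.2 a⟩⟩
      invFun := fun f =>
        (⟨fun i => (f.1 i).1, fun a =>
          ((fiberCard_pair_eq_iff fun h => f.1 (g.symm (a, h)).1).mpr (f.2 a)).1⟩,
        ⟨fun i => (f.1 i).2, fun a =>
          ((fiberCard_pair_eq_iff fun h => f.1 (g.symm (a, h)).1).mpr (f.2 a)).2⟩)
      left_inv := fun _ => rfl
      right_inv := fun _ => rfl }

lemma factorial_mul_moment {k d j n m : ℕ} (hk : 0 < k) (hm : d * n = k * m) :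
    ((d * n).factorial : ℝ) * moment k d j n =
      ((∑ g : Configuration k d n m, numSolutions g ^ j : ℕ) : ℝ) := by
  obtain rfl : m = d * n / k := by rw [hm, Nat.mul_div_cancel_left _ hk]
  have hcard : Fintype.card (Configuration k d n (d * n / k)) = (d * n).factorial := by
    have h : Fintype.card (Fin n × Fin d) = Fintype.card (Fin (d * n / k) × Fin k) := by
      simp only [Fintype.card_prod, Fintype.card_fin]
      rw [mul_comm n, mul_comm _ k]
      exact hm
    rw [Fintype.card_equiv (Fintype.equivOfCardEq h)]
    simp [mul_comm n]
  rw [moment, Finset.expect_eq_sum_div_card, Finset.card_univ, hcard, mul_div_cancel₀]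
  · push_cast; rfl
  · positivity

lemma sum_sum_sum_comm {α β γ R : Type*} [AddCommMonoid R] (s : Finset α) (t : Finset β)
    (u : Finset γ) (X : α → β → γ → R) :
    ∑ a ∈ s, ∑ b ∈ t, ∑ c ∈ u, X a b c = ∑ c ∈ u, ∑ a ∈ s, ∑ b ∈ t, X a b c := by
  rw [Finset.sum_comm (s := u)]
  exact Finset.sum_congr rfl fun a _ => Finset.sum_comm

lemma labelCount_eq_sum {C : Type*} [Fintype C] [DecidableEq C] (N : ℕ) (v : C → ℤ) :
    labelCount N v = ∑ f : Fin N → C, if ∀ c, (fiberCard f c : ℤ) = v c then 1 else 0 := by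
  rw [labelCount, Nat.card_eq_fintype_card, Fintype.card_subtype, Finset.card_filter]

/-- The first moment. -/
lemma factorial_mul_moment_one {k d n m l : ℕ} (hk : 0 < k) (hd : 0 < d) (hm : d * n = k * m)
    (hl : d * l = 2 * m) :
    ((d * n).factorial : ℝ) * moment k d 1 n =
      ((labelCount n (valueCount n l) * labelCount k (valueCount k 2) ^ m *
        ∏ c, (d * valueCount n l c).toNat.factorial : ℕ) : ℝ) := by
  classical
  rw [factorial_mul_moment hk hm]
  simp only [pow_one, numSolutions_eq]
  rw [sum_card_labellings _ (Function.injective_of_subsingleton _), labelCount_eq_sum n,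
    Finset.sum_mul, Finset.sum_mul]
  congr 1
  refine Finset.sum_congr rfl fun f _ => ?_
  have hiff : (∀ c, (d * fiberCard f c : ℤ) = m • valueCount k 2 c) ↔
      ∀ c, (fiberCard f c : ℤ) = valueCount n l c := by
    have hd' : (d : ℤ) ≠ 0 := by positivity
    zify at hm hl
    refine forall_congr' fun c => ?_
    rw [nsmul_eq_mul,
      show (m : ℤ) * valueCount k 2 c = d * valueCount n l c by
        cases c <;> simp only [valueCount, cond_true, cond_false] <;> linarith]
    exact mul_right_inj' hd'
  simp only [Finset.sum_const, Finset.card_univ, Fintype.card_pi, Fintype.card_unit,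
    Finset.prod_const_one, one_smul, Finset.prod_const, Fintype.card_fin, hiff]
  split_ifs with h
  · rw [one_mul]
    congr 1
    refine Finset.prod_congr rfl fun c _ => ?_
    rw [← h c, ← Nat.cast_mul, Int.toNat_natCast]
  · simp

/-- The second moment, as a sum over the overlap `r` of the two assignments and the number `s` of
constraints with overlap two. -/
lemma factorial_mul_moment_two {k d n m l : ℕ} (hk : 3 < k) (hd : 0 < d) (hm : d * n = k * m)
    (hl : d * l = 2 * m) :
    ((d * n).factorial : ℝ) * moment k d 2 n =
      ((∑ r ∈ Finset.Icc (0 : ℤ) n, ∑ s ∈ Finset.Icc (0 : ℤ) m,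
        labelCount n (overlapCount n l r) * labelCount m (typeCount m (d * r) s) *
          ((∏ t : Fin 3, labelCount k (overlapCount k 2 (t : ℕ)) ^ (typeCount m (d * r) s t).toNat) *
            ∏ c, (d * overlapCount n l r c).toNat.factorial) : ℕ) : ℝ) := by
  classical
  rw [factorial_mul_moment (by omega) hm]
  simp only [numSolutions_sq_eq]
  rw [sum_card_labellings]
  swap
  · intro t t' h
    have := congrFun h (true, true)
    simp only [overlapCount, cond_true] at this
    omega
  congr 1
  set G : ℤ → ℤ → ℕ := fun r s =>
    (∏ t : Fin 3, labelCount k (overlapCount k 2 (t : ℕ)) ^ (typeCount m (d * r) s t).toNat) *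
      ∏ c, (d * overlapCount n l r c).toNat.factorial
  have hsplit : ∀ r s, labelCount n (overlapCount n l r) * labelCount m (typeCount m (d * r) s) *
      G r s = ∑ f : Fin n → Bool × Bool, ∑ τ : Fin m → Fin 3,
        if (∀ c, (fiberCard f c : ℤ) = overlapCount n l r c) ∧
          ∀ t, (fiberCard τ t : ℤ) = typeCount m (d * r) s t then G r s else 0 := fun r s => by
    rw [labelCount_eq_sum n, labelCount_eq_sum m, Finset.sum_mul_sum, Finset.sum_mul]
    refine Finset.sum_congr rfl fun f _ => ?_
    rw [Finset.sum_mul]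
    refine Finset.sum_congr rfl fun τ _ => ?_
    rw [ite_zero_mul_ite_zero, mul_one, ite_mul, one_mul, zero_mul]
    congr
  change _ = ∑ r ∈ Finset.Icc (0 : ℤ) n, ∑ s ∈ Finset.Icc (0 : ℤ) m,
    labelCount n (overlapCount n l r) * labelCount m (typeCount m (d * r) s) * G r s
  simp only [hsplit]
  rw [sum_sum_sum_comm]
  refine Finset.sum_congr rfl fun f _ => ?_
  rw [sum_sum_sum_comm]
  refine Finset.sum_congr rfl fun τ _ => ?_
  have hf := sum_fiberCard f
  have hτ := sum_fiberCard τ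
  simp only [Fintype.sum_prod_type, Fintype.sum_bool, Fintype.card_fin, Fin.sum_univ_three] at hf hτ
  have hsum : ∀ φ : Fin 3 → ℤ, ∑ a, φ (τ a) =
      fiberCard τ 0 * φ 0 + fiberCard τ 1 * φ 1 + fiberCard τ 2 * φ 2 := fun φ => by
    rw [sum_comp_eq_sum_fiberCard_mul, Fin.sum_univ_three]
  have hiff : ∀ r s : ℤ, ((∀ c, (fiberCard f c : ℤ) = overlapCount n l r c) ∧
      ∀ t, (fiberCard τ t : ℤ) = typeCount m (d * r) s t) ↔
      (∀ c, (d * fiberCard f c : ℤ) = ∑ a, overlapCount k 2 (τ a : ℕ) c) ∧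
        r = fiberCard f (true, true) ∧ s = fiberCard τ 2 := fun r s => by
    have hd' : (d : ℤ) ≠ 0 := by positivity
    zify at hm hl hf hτ
    have e : ∀ c, ∑ a, overlapCount k 2 (τ a : ℕ) c =
        fiberCard τ 0 * overlapCount k 2 0 c + fiberCard τ 1 * overlapCount k 2 1 c +
          fiberCard τ 2 * overlapCount k 2 2 c := fun c => hsum fun t => overlapCount k 2 (t : ℕ) c
    have e' : (∀ t, (fiberCard τ t : ℤ) = typeCount m (d * r) s t) ↔
        (fiberCard τ 0 : ℤ) = m + s - d * r ∧ (fiberCard τ 1 : ℤ) = d * r - 2 * s ∧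
          (fiberCard τ 2 : ℤ) = s := by
      simp [Fin.forall_fin_succ, typeCount]
    simp only [e, e', forall_bool_prod]
    simp only [overlapCount, cond_true, cond_false]
    clear e e' hsum hsplit
    constructor
    · rintro ⟨⟨h1, h2, h3, h4⟩, h5, h6, h7⟩
      refine ⟨⟨?_, ?_, ?_, ?_⟩, h1.symm, h7.symm⟩
      all_goals rw [h5, h6, h7]
      · rw [h1]; ring
      · rw [h2]; linear_combination hl
      · rw [h3]; linear_combination hl
      · rw [h4]; linear_combination hm - 2 * hl
    · rintro ⟨⟨h1, h2, h3, h4⟩, rfl, rfl⟩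
      have h5 : (fiberCard τ 1 : ℤ) = d * fiberCard f (true, true) - 2 * fiberCard τ 2 := by
        linarith
      have h6 : (fiberCard τ 0 : ℤ) = m + fiberCard τ 2 - d * fiberCard f (true, true) := by
        linarith
      have h7 : (fiberCard f (true, false) : ℤ) = l - fiberCard f (true, true) :=
        mul_left_cancel₀ hd' (by rw [h2, h5, h6]; linear_combination -hl)
      have h8 : (fiberCard f (false, true) : ℤ) = l - fiberCard f (true, true) :=
        mul_left_cancel₀ hd' (by rw [h3, h5, h6]; linear_combination -hl)
      exact ⟨⟨rfl, h7, h8, by linarith⟩, h6, h5, rfl⟩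
  by_cases h : ∀ c, (d * fiberCard f c : ℤ) = ∑ a, overlapCount k 2 (τ a : ℕ) c
  · rw [if_pos h, Finset.sum_eq_single (fiberCard f (true, true) : ℤ),
      Finset.sum_eq_single (fiberCard τ 2 : ℤ), if_pos ((hiff _ _).mpr ⟨h, rfl, rfl⟩)]
    · obtain ⟨h1, h2⟩ := (hiff _ _).mpr ⟨h, rfl, rfl⟩
      simp only [G]
      rw [prod_comp_eq_prod_pow_fiberCard τ fun t => labelCount k (overlapCount k 2 (t : ℕ))]
      congr 1
      · refine Finset.prod_congr rfl fun t _ => ?_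
        rw [← h2 t, Int.toNat_natCast]
      · refine Finset.prod_congr rfl fun c _ => ?_
        rw [← h1 c, ← Nat.cast_mul, Int.toNat_natCast]
    · intro s _ hs
      rw [if_neg fun hh => hs ((hiff _ _).mp hh).2.2]
    · intro hs
      exact absurd (Finset.mem_Icc.mpr ⟨by positivity, by exact_mod_cast (by omega)⟩) hs
    · intro r _ hr
      refine Finset.sum_eq_zero fun s _ => ?_
      rw [if_neg fun hh => hr ((hiff _ _).mp hh).2.1]
    · intro hr
      exact absurd (Finset.mem_Icc.mpr ⟨by positivity, by exact_mod_cast (by omega)⟩) hr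
  · rw [if_neg h]
    symm
    refine Finset.sum_eq_zero fun r _ => Finset.sum_eq_zero fun s _ => ?_
    rw [if_neg fun hh => h ((hiff _ _).mp hh).1]

/-! ### The moment ratio as a sum of Poisson weights -/

/-- The Bernoulli law with mean `w`. -/
noncomputable def bernoulliPmf (w : ℝ) : Bool → ℝ := fun c => bif c then w else 1 - w

/-- The law of two independent Bernoulli variables with mean `w`. -/
noncomputable def cellPmf (w : ℝ) : Bool × Bool → ℝ :=
  fun c => bernoulliPmf w c.1 * bernoulliPmf w c.2

lemma sum_bernoulliPmf (w : ℝ) : ∑ c, bernoulliPmf w c = 1 := by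
  simp [bernoulliPmf]

lemma sum_cellPmf (w : ℝ) : ∑ c, cellPmf w c = 1 := by
  simp [cellPmf, bernoulliPmf, Fintype.sum_prod_type]
  ring

lemma bernoulliPmf_pos {w : ℝ} (h0 : 0 < w) (h1 : w < 1) (c : Bool) : 0 < bernoulliPmf w c := by
  cases c <;> simp [bernoulliPmf, h0, h1]

lemma cellPmf_pos {w : ℝ} (h0 : 0 < w) (h1 : w < 1) (c : Bool × Bool) : 0 < cellPmf w c :=
  mul_pos (bernoulliPmf_pos h0 h1 _) (bernoulliPmf_pos h0 h1 _)

/-- The contribution of overlap `r` of the assignments, and of `s` constraints with overlap two, to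
the ratio of the second moment and the square of the first moment; `m` is the number of constraints
and `l` the number of ones in a solution. -/
noncomputable def overlapTerm (k d n m l : ℕ) (r s : ℤ) : ℝ :=
  (∏ t, poissonWeight (m * inPmf (wstar k) t) (typeCount m (d * r) s t)) / poissonWeight m m *
    ((∏ c, poissonWeight (n * cellPmf (w1star k) c) (overlapCount n l r c) /
      poissonWeight (d * (n * cellPmf (w1star k) c)) (d * overlapCount n l r c)) *
    ((poissonWeight (d * l) (d * l) / poissonWeight l l *
      (poissonWeight (d * (n - l : ℕ)) (d * (n - l : ℕ)) /
        poissonWeight (n - l : ℕ) (n - l : ℕ))) ^ 2 *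
      (poissonWeight n n / poissonWeight (d * n) (d * n))))

lemma prod_cellPmf_pow {n l : ℕ} {r : ℤ} (w : ℝ) (h : ∀ c, 0 ≤ overlapCount n l r c) (e : ℕ) :
    ∏ c, cellPmf w c ^ (e * overlapCount n l r c).toNat = ((w ^ l * (1 - w) ^ (n - l)) ^ 2) ^ e := by
  have h1 : ∀ c, (e * overlapCount n l r c).toNat = (overlapCount n l r c).toNat * e := fun c => by
    rw [Int.toNat_mul (by positivity) (h c), Int.toNat_natCast, mul_comm]
  simp only [h1, pow_mul _ _ e]
  rw [Finset.prod_pow]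
  congr 1
  simp only [forall_bool_prod, overlapCount, cond_true, cond_false] at h
  simp only [Fintype.prod_prod_type, Fintype.prod_bool, overlapCount, cond_true, cond_false,
    cellPmf, bernoulliPmf]
  obtain ⟨h1, h2, -, h4⟩ := h
  obtain ⟨a, ha⟩ := Int.eq_ofNat_of_zero_le h1
  obtain ⟨b, hb⟩ := Int.eq_ofNat_of_zero_le h2
  obtain ⟨c, hc⟩ := Int.eq_ofNat_of_zero_le h4
  rw [ha] at hb hc ⊢
  rw [hb, hc]
  simp only [Int.toNat_natCast]
  obtain rfl : l = a + b := by omega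
  have hn : n - (a + b) = b + c := by omega
  rw [hn]
  generalize 1 - w = v
  ring

/-- The multinomial coefficients of the variables in the moment ratio, as Poisson weights. The powers
of the probabilities cancel, since a pair of assignments has `2 l` ones whatever the overlap. -/
lemma labelCount_ratio {d n l : ℕ} (hd : 0 < d) (hl : 0 < l) (hln : l < n) {w : ℝ}
    (hw : (n : ℝ) * w = l) (r : ℤ) :
    (labelCount n (overlapCount n l r) : ℝ) /
        labelCount (d * n) (fun c => d * overlapCount n l r c) /
      ((labelCount n (valueCount n l) : ℝ) /
        labelCount (d * n) (fun c => d * valueCount n l c)) ^ 2 =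
    (∏ c, poissonWeight (n * cellPmf w c) (overlapCount n l r c) /
      poissonWeight (d * (n * cellPmf w c)) (d * overlapCount n l r c)) *
    ((poissonWeight (d * l) (d * l) / poissonWeight l l *
      (poissonWeight (d * (n - l : ℕ)) (d * (n - l : ℕ)) /
        poissonWeight (n - l : ℕ) (n - l : ℕ))) ^ 2 *
      (poissonWeight n n / poissonWeight (d * n) (d * n))) := by
  by_cases h : ∀ c, 0 ≤ overlapCount n l r c
  swap
  · push Not at h
    obtain ⟨c, hc⟩ := h
    rw [labelCount_of_neg n hc, Finset.prod_eq_zero (Finset.mem_univ c)]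
    · simp
    · rw [poissonWeight_of_neg _ hc, zero_div]
  have hn : 0 < n := by omega
  have hn' : (0 : ℝ) < n := by positivity
  have hl' : (0 : ℝ) < l := by positivity
  have hln' : (l : ℝ) < n := by exact_mod_cast hln
  have hw0 : 0 < w := by
    by_contra hw0
    nlinarith
  have hw1 : w < 1 := by
    by_contra hw1
    nlinarith
  have hdn : 0 < d * n := by positivity
  have hA := labelCount_mul_prod_pow hn (sum_overlapCount n l r) (sum_cellPmf w)
  have hA' := labelCount_mul_prod_pow hdn (v := fun c => d * overlapCount n l r c)
    (by rw [← Finset.mul_sum, sum_overlapCount]; push_cast; rfl) (sum_cellPmf w)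
  have hB := labelCount_mul_prod_pow hn (sum_valueCount n l) (sum_bernoulliPmf w)
  have hB' := labelCount_mul_prod_pow hdn (v := fun c => d * valueCount n l c)
    (by rw [← Finset.mul_sum, sum_valueCount]; push_cast; rfl) (sum_bernoulliPmf w)
  have e1 := prod_cellPmf_pow w h 1
  have e2 := prod_cellPmf_pow w h d
  simp only [Nat.cast_one, one_mul, pow_one] at e1
  have hnl : (n : ℤ) - l = (n - l : ℕ) := by omega
  have hnw : (n : ℝ) * (1 - w) = (n - l : ℕ) := by
    rw [Nat.cast_sub hln.le, mul_sub, hw, mul_one]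
  have e3 : ∏ c, bernoulliPmf w c ^ (valueCount n l c).toNat = w ^ l * (1 - w) ^ (n - l) := by
    simp [valueCount, bernoulliPmf, hnl]
  have e4 : ∏ c, bernoulliPmf w c ^ (d * valueCount n l c).toNat =
      (w ^ l * (1 - w) ^ (n - l)) ^ d := by
    simp only [Fintype.prod_bool, valueCount, bernoulliPmf, cond_true, cond_false, hnl,
      ← Nat.cast_mul, Int.toNat_natCast]
    rw [mul_pow, ← pow_mul, ← pow_mul, mul_comm d, mul_comm d]
  have e5 : ∏ c, poissonWeight (n * bernoulliPmf w c) (valueCount n l c) =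
      poissonWeight l l * poissonWeight (n - l : ℕ) (n - l : ℕ) := by
    simp [valueCount, bernoulliPmf, hnl, hw, hnw]
  have e6 : ∏ c, poissonWeight ((d * n : ℕ) * bernoulliPmf w c) (d * valueCount n l c) =
      poissonWeight (d * l) (d * l) * poissonWeight (d * (n - l : ℕ)) (d * (n - l : ℕ)) := by
    simp [valueCount, bernoulliPmf, hnl, hw, hnw, mul_assoc]
  rw [e1] at hA
  rw [e2, pow_right_comm] at hA'
  rw [e3, e5] at hB
  rw [e4, e6] at hB'
  simp only [Nat.cast_mul, mul_assoc] at hA' hB'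
  rw [Finset.prod_div_distrib]
  have hd' : (0 : ℝ) < d := by positivity
  have hnl0 : (0 : ℝ) < (n - l : ℕ) := by exact_mod_cast Nat.sub_pos_of_lt hln
  have p1 : 0 < poissonWeight l l := poissonWeight_pos hl' (by positivity)
  have p2 : 0 < poissonWeight (n - l : ℕ) (n - l : ℕ) := poissonWeight_pos hnl0 (by positivity)
  have p3 : 0 < poissonWeight (d * l) (d * l) := poissonWeight_pos (by positivity) (by positivity)
  have p4 : 0 < poissonWeight (d * (n - l : ℕ)) (d * (n - l : ℕ)) :=
    poissonWeight_pos (by positivity) (by positivity)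
  have p5 : 0 < poissonWeight n n := poissonWeight_pos hn' (by positivity)
  have p6 : 0 < poissonWeight (d * n) (d * n) := poissonWeight_pos (by positivity) (by positivity)
  have p7 : 0 < ∏ c, poissonWeight (d * (n * cellPmf w c)) (d * overlapCount n l r c) :=
    Finset.prod_pos fun c _ => poissonWeight_pos
      (by have := cellPmf_pos hw0 hw1 c; positivity) (mul_nonneg (by positivity) (h c))
  have hQ : 0 < w ^ l * (1 - w) ^ (n - l) := by
    have : 0 < 1 - w := by linarith
    positivity
  set Q := w ^ l * (1 - w) ^ (n - l)
  rw [← eq_div_iff (by positivity)] at hA hA' hB hB'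
  rw [hA, hA', hB, hB']
  field_simp

lemma inPmf_wstar {k : ℕ} (hk : 3 < k) :
    inPmf (wstar k) = ![((k : ℝ) - 2) * (k - 3) / (k * (k - 1)), 4 * ((k : ℝ) - 2) / (k * (k - 1)),
      2 / ((k : ℝ) * (k - 1))] := by
  have h3 : (3 : ℝ) < k := by exact_mod_cast hk
  have h1 : (k : ℝ) - 1 ≠ 0 := by linarith
  have h0 : (k : ℝ) ≠ 0 := by linarith
  simp only [inPmf, wstar, w1star, w2star, Nat.cast_choose_two, Matrix.cons_val_zero,
    Matrix.cons_val_one]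
  congr 1
  · field_simp; ring
  congr 1
  · field_simp; ring
  congr 1
  field_simp

lemma inPmf_wstar_pos {k : ℕ} (hk : 3 < k) (t : Fin 3) : 0 < inPmf (wstar k) t := by
  have h3 : (3 : ℝ) < k := by exact_mod_cast hk
  have h0 : 0 < (k : ℝ) - 1 := by linarith
  have h1 : 0 < (k : ℝ) - 2 := by linarith
  have h2 : 0 < (k : ℝ) - 3 := by linarith
  rw [inPmf_wstar hk]
  fin_cases t
  · change 0 < ((k : ℝ) - 2) * (k - 3) / (k * (k - 1)); positivity
  · change 0 < 4 * ((k : ℝ) - 2) / (k * (k - 1)); positivity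
  · change 0 < 2 / ((k : ℝ) * (k - 1)); positivity

lemma labelCount_valueCount_two {k : ℕ} (hk : 3 < k) :
    (labelCount k (valueCount k 2) : ℝ) = k * (k - 1) / 2 := by
  obtain ⟨j, rfl⟩ : ∃ j, k = j + 4 := ⟨k - 4, by omega⟩
  have h := labelCount_mul_prod_factorial (N := j + 4)
    (v := fun c : Bool => bif c then 2 else j + 2) (by simp; ring)
  have e : (fun c : Bool => ((bif c then 2 else j + 2 : ℕ) : ℤ)) = valueCount (j + 4 : ℕ) 2 := by
    funext c
    cases c <;> simp [valueCount]
    ring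
  rw [e] at h
  simp only [Fintype.prod_bool, cond_true, cond_false, Nat.factorial_succ, Nat.factorial_zero] at h
  have h' : ((labelCount (j + 4) (valueCount (j + 4 : ℕ) 2) : ℝ) * 2) * j.factorial *
      ((j + 2) * (j + 1)) = ((j + 4) * (j + 3)) * j.factorial * ((j + 2) * (j + 1)) := by
    exact_mod_cast (by linarith)
  have hj : (j.factorial : ℝ) ≠ 0 := by positivity
  have h'' := mul_right_cancel₀ hj (mul_right_cancel₀ (by positivity) h')
  generalize labelCount _ _ = Ω at h'' ⊢
  push_cast
  linarith

/-- Two independent uniform pairs from `k` points have `t` points in common with probability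
`p(w*) t`. -/
lemma labelCount_overlapCount_two {k : ℕ} (hk : 3 < k) (t : Fin 3) :
    (labelCount k (overlapCount k 2 (t : ℕ)) : ℝ) =
      (labelCount k (valueCount k 2) : ℝ) ^ 2 * inPmf (wstar k) t := by
  rw [labelCount_valueCount_two hk, inPmf_wstar hk]
  obtain ⟨j, rfl⟩ : ∃ j, k = j + 4 := ⟨k - 4, by omega⟩
  have h := labelCount_mul_prod_factorial (N := j + 4)
    (v := fun c : Bool × Bool => bif c.1 then (bif c.2 then (t : ℕ) else 2 - t) else
      (bif c.2 then 2 - t else j + t)) (by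
        simp only [Fintype.sum_prod_type, Fintype.sum_bool, cond_true, cond_false]; omega)
  have e : (fun c : Bool × Bool => ((bif c.1 then (bif c.2 then (t : ℕ) else 2 - t) else
      (bif c.2 then 2 - t else j + t) : ℕ) : ℤ)) = overlapCount (j + 4 : ℕ) 2 (t : ℕ) := by
    funext c
    rcases c with ⟨_ | _, _ | _⟩ <;> simp only [overlapCount, cond_true, cond_false] <;> omega
  rw [e] at h
  generalize labelCount _ _ = Ω at h ⊢
  have hj : (j.factorial : ℝ) ≠ 0 := by positivity
  have h1 : (j : ℝ) + 4 - 1 ≠ 0 := by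
    have : (0 : ℝ) ≤ j := by positivity
    linarith
  fin_cases t
  all_goals
    simp [Fintype.prod_prod_type, Nat.factorial_succ] at h ⊢
    replace h := congrArg (Nat.cast : ℕ → ℝ) h
    push_cast at h
  · have h2 : (Ω : ℝ) = (j + 4) * (j + 3) * (j + 2) * (j + 1) / 4 :=
      mul_right_cancel₀ hj (by linear_combination h / 4)
    rw [h2]
    field_simp
    ring
  · have h2 : (Ω : ℝ) = (j + 4) * (j + 3) * (j + 2) :=
      mul_right_cancel₀ (mul_ne_zero hj (show (j : ℝ) + 1 ≠ 0 by positivity))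
        (by linear_combination h)
    rw [h2]
    field_simp
    ring
  · have h2 : (Ω : ℝ) = (j + 4) * (j + 3) / 2 :=
      mul_right_cancel₀ (mul_ne_zero hj
        (show ((j : ℝ) + 1) * (j + 2) ≠ 0 by positivity)) (by linear_combination h / 2)
    rw [h2]
    field_simp
    ring

/-- The moment ratio as a sum over the overlap `r` of two assignments and the number `s` of
constraints on which they share both ones; terms with a negative count vanish. -/
theorem moment_two_div_sq {k d n m l : ℕ} (hk : 3 < k) (hd : 0 < d) (hn : 0 < n)
    (hm : d * n = k * m) (hl : k * l = 2 * n) :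
    moment k d 2 n / moment k d 1 n ^ 2 =
      ∑ r ∈ Finset.Icc (0 : ℤ) n, ∑ s ∈ Finset.Icc (0 : ℤ) m, overlapTerm k d n m l r s := by
  have hdl : d * l = 2 * m := by
    apply Nat.eq_of_mul_eq_mul_left (show 0 < k by omega)
    calc k * (d * l) = d * (k * l) := by ring
      _ = 2 * (d * n) := by rw [hl]; ring
      _ = k * (2 * m) := by rw [hm]; ring
  have hl0 : 0 < l := by
    rcases Nat.eq_zero_or_pos l with rfl | h
    · omega
    · exact h
  have hln : l < n := by nlinarith
  have hm0 : 0 < m := by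
    rcases Nat.eq_zero_or_pos m with rfl | h
    · have := Nat.mul_pos hd hn
      omega
    · exact h
  have hF : ((d * n).factorial : ℝ) ≠ 0 := by positivity
  have h1 := factorial_mul_moment_one (by omega) hd hm hdl
  have h2 := factorial_mul_moment_two hk hd hm hdl
  rw [mul_comm, ← eq_div_iff hF] at h1 h2
  rw [h1, h2]
  push_cast
  rw [Finset.sum_div, Finset.sum_div]
  refine Finset.sum_congr rfl fun r _ => ?_
  rw [Finset.sum_div, Finset.sum_div]
  refine Finset.sum_congr rfl fun s _ => ?_
  have hw : (n : ℝ) * w1star k = l := by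
    have : (k : ℝ) * l = 2 * n := by exact_mod_cast hl
    rw [w1star]
    field_simp
    linarith
  rw [overlapTerm, ← labelCount_ratio hd hl0 hln hw r,
    ← labelCount_mul_prod_pow hm0 (sum_typeCount _ _ _) (by
      simp [inPmf, Fin.sum_univ_three]; ring)]
  simp only [labelCount_overlapCount_two hk, mul_pow]
  rw [Finset.prod_mul_distrib, Finset.prod_pow_eq_pow_sum]
  have hdv : ∀ c, 0 ≤ (d : ℤ) * valueCount n l c := fun c => by
    cases c <;> simp only [valueCount, cond_true, cond_false]
    · exact mul_nonneg (by positivity) (by omega)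
    · positivity
  have hv : ∀ c, 0 ≤ valueCount n l c := fun c =>
    nonneg_of_mul_nonneg_right (hdv c) (by positivity)
  have hV := labelCount_mul_prod_toNat_factorial (N := d * n) hdv
    (by rw [← Finset.mul_sum, sum_valueCount]; push_cast; rfl)
  have hA1 := labelCount_mul_prod_toNat_factorial hv (sum_valueCount _ _)
  by_cases hα : ∀ c, 0 ≤ overlapCount n l r c
  swap
  · push Not at hα
    obtain ⟨c, hc⟩ := hα
    simp [labelCount_of_neg n hc]
  by_cases hβ : ∀ t, 0 ≤ typeCount m (d * r) s t
  swap
  · push Not at hβ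
    obtain ⟨c, hc⟩ := hβ
    simp [labelCount_of_neg m hc]
  have hW := labelCount_mul_prod_toNat_factorial (N := d * n)
    (fun c => mul_nonneg (by positivity : (0 : ℤ) ≤ d) (hα c))
    (by rw [← Finset.mul_sum, sum_overlapCount]; push_cast; rfl)
  have hsum : ∑ t, (typeCount m (d * r) s t).toNat = m := by
    have := sum_typeCount m (d * r) s
    zify
    exact (Finset.sum_congr rfl fun t _ => Int.toNat_of_nonneg (hβ t)).trans this
  rw [hsum, pow_right_comm]
  have hΩ : (labelCount k (valueCount k 2) : ℝ) ≠ 0 := by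
    have h3 : (3 : ℝ) < k := by exact_mod_cast hk
    rw [labelCount_valueCount_two hk]
    have : (k : ℝ) - 1 ≠ 0 := by linarith
    positivity
  have hA1' : (labelCount n (valueCount n l) : ℝ) ≠ 0 := by
    have : labelCount n (valueCount n l) ≠ 0 := by
      intro h0
      rw [h0, zero_mul] at hA1
      exact (Nat.factorial_pos n).ne hA1
    exact_mod_cast this
  have hW0 : ∏ c, ((d * overlapCount n l r c).toNat.factorial : ℝ) ≠ 0 :=
    Finset.prod_ne_zero_iff.mpr fun c _ => by positivity
  have hV0 : ∏ c, ((d * valueCount n l c).toNat.factorial : ℝ) ≠ 0 :=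
    Finset.prod_ne_zero_iff.mpr fun c _ => by positivity
  have hW' : (labelCount (d * n) (fun c => d * overlapCount n l r c) : ℝ) *
      ∏ c, ((d * overlapCount n l r c).toNat.factorial : ℝ) = (d * n).factorial := by
    exact_mod_cast hW
  have hV' : (labelCount (d * n) (fun c => d * valueCount n l c) : ℝ) *
      ∏ c, ((d * valueCount n l c).toNat.factorial : ℝ) = (d * n).factorial := by
    exact_mod_cast hV
  rw [← eq_div_iff hW0] at hW'
  rw [← eq_div_iff hV0] at hV'
  rw [hW', hV']
  field_simp

/-! ### Divergences and the contraction inequality -/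

lemma kl_eq_sum_poissonCost {ι : Type*} [Fintype ι] {a b : ι → ℝ} (h : ∑ i, a i = ∑ i, b i) :
    kl a b = ∑ i, poissonCost (b i) (a i) := by
  simp only [kl, poissonCost, Finset.sum_add_distrib, Finset.sum_sub_distrib, h]
  ring

/-- A quadratic lower bound in the spirit of Pinsker's inequality. -/
lemma sum_sq_sub_le_kl {ι : Type*} [Fintype ι] {a b : ι → ℝ} (ha : a ∈ stdSimplex ℝ ι)
    (hb : b ∈ stdSimplex ℝ ι) (hb0 : ∀ i, 0 < b i) :
    (∑ i, (a i - b i) ^ 2) / 4 ≤ kl a b := by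
  rw [kl_eq_sum_poissonCost (ha.2.trans hb.2.symm), Finset.sum_div]
  refine Finset.sum_le_sum fun i _ => ?_
  refine le_trans ?_ (sq_sqrt_sub_le_poissonCost (hb0 i) (ha.1 i))
  have h1 : ∀ {c : ι → ℝ}, c ∈ stdSimplex ℝ ι → √(c i) ≤ 1 := fun hc =>
    Real.sqrt_le_one.mpr (mem_Icc_of_mem_stdSimplex hc i).2
  have h2 : a i - b i = (√(a i) - √(b i)) * (√(a i) + √(b i)) := by
    linear_combination Real.sq_sqrt (hb.1 i) - Real.sq_sqrt (ha.1 i)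
  have h3 : (√(a i) + √(b i)) ^ 2 ≤ 4 := by
    have := h1 ha
    have := h1 hb
    nlinarith [Real.sqrt_nonneg (a i), Real.sqrt_nonneg (b i)]
  rw [h2, mul_pow]
  nlinarith [sq_nonneg (√(a i) - √(b i))]

lemma kl_pos {ι : Type*} [Fintype ι] {a b : ι → ℝ} (ha : a ∈ stdSimplex ℝ ι)
    (hb : b ∈ stdSimplex ℝ ι) (hb0 : ∀ i, 0 < b i) (hab : a ≠ b) : 0 < kl a b := by
  refine lt_of_lt_of_le ?_ (sum_sq_sub_le_kl ha hb hb0)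
  obtain ⟨i, hi⟩ := Function.ne_iff.mp hab
  have : 0 < ∑ i, (a i - b i) ^ 2 :=
    Finset.sum_pos' (fun _ _ => sq_nonneg _)
      ⟨i, Finset.mem_univ i, by have := sub_ne_zero.mpr hi; positivity⟩
  positivity

lemma kl_self {ι : Type*} [Fintype ι] (b : ι → ℝ) : kl b b = 0 := by
  refine Finset.sum_eq_zero fun i _ => ?_
  rcases eq_or_ne (b i) 0 with h | h
  · simp [h]
  · simp [div_self h]

lemma inPmf_mem_stdSimplex {w : Fin 2 → ℝ} (hw : w ∈ domain) :
    inPmf w ∈ stdSimplex ℝ (Fin 3) := by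
  obtain ⟨h1, h2, h3⟩ := hw
  refine ⟨fun i => ?_, by simp [inPmf, Fin.sum_univ_three]; ring⟩
  fin_cases i
  · simp [inPmf]; linarith
  · simp [inPmf]; linarith
  · simpa [inPmf] using (h1 1).1

lemma inPmf_injective : Function.Injective inPmf := fun w w' h => by
  have h1 := congrFun h 1
  have h2 := congrFun h 2
  simp [inPmf] at h1 h2
  funext i
  fin_cases i
  · simp; linarith
  · simpa using h2

section Constants

variable {k d : ℕ}

lemma wstar_mem_domain (hk : 3 < k) : wstar k ∈ domain := by
  have h := inPmf_wstar_pos hk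
  have h3 : (3 : ℝ) < k := by exact_mod_cast hk
  have h0 := h 0
  have h1 := h 1
  have h2 := h 2
  have h4 : w1star k ≤ 1 := by
    rw [w1star, div_le_one (by linarith)]
    linarith
  simp [inPmf, wstar] at h0 h1 h2
  refine ⟨fun i => ?_, ?_, ?_⟩
  · fin_cases i
    · simp [wstar]; constructor <;> linarith
    · simp [wstar]; constructor <;> linarith
  · simp [wstar]; linarith
  · simp [wstar]; linarith

lemma w1star_pos (hk : 3 < k) : 0 < w1star k := by
  rw [w1star]
  have : 0 < k := by omega
  positivity

lemma w1star_lt_one (hk : 3 < k) : w1star k < 1 := by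
  have h3 : (3 : ℝ) < k := by exact_mod_cast hk
  rw [w1star, div_lt_one (by linarith)]
  linarith

lemma w2star_pos (hk : 3 < k) : 0 < w2star k := by
  have := inPmf_wstar_pos hk 2
  simpa [inPmf, wstar] using this

lemma w2star_lt_one (hk : 3 < k) : w2star k < 1 := by
  have := inPmf_wstar_pos hk 1
  simp [inPmf, wstar] at this
  linarith [w1star_lt_one hk]

/-- Below the threshold the contraction coefficient is smaller than `(d / k) / (d - 1)`. -/
lemma coefficient_lt (hk : 3 < k) (hd : 1 < d) (hdk : (d : ℝ) < dstar k) :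
    ((d : ℝ) - 1) * (Real.binEntropy (w1star k) / (-Real.log (w2star k))) < (d : ℝ) / k := by
  have hH := Real.binEntropy_pos (w1star_pos hk) (w1star_lt_one hk)
  have hl := Real.log_neg (w2star_pos hk) (w2star_lt_one hk)
  have hd' : (1 : ℝ) < d := by exact_mod_cast hd
  have h3 : (3 : ℝ) < k := by exact_mod_cast hk
  set H := Real.binEntropy (w1star k)
  set ℓ := Real.log (w2star k)
  have hkH : 0 < (k : ℝ) * H := by positivity
  rw [dstar] at hdk
  have hD : 0 < (k : ℝ) * H + ℓ := by
    by_contra hD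
    have := div_nonpos_of_nonneg_of_nonpos hkH.le (not_lt.mp hD)
    linarith
  rw [lt_div_iff₀ hD] at hdk
  rw [← mul_div_assoc, div_lt_div_iff₀ (by linarith) (by linarith)]
  nlinarith

lemma kl_outPmf_le (hk : 3 < k) (hconj : ContractionConjecture k) {w : Fin 2 → ℝ}
    (hw : w ∈ domain) :
    kl (outPmf k w) (outPmf k (wstar k)) ≤
      Real.binEntropy (w1star k) / (-Real.log (w2star k)) * kl (inPmf w) (inPmf (wstar k)) := by
  by_cases h : w = wstar k
  · subst h
    simp [kl_self]
  have hne : inPmf w ≠ inPmf (wstar k) := fun h' => h (inPmf_injective h')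
  have h1 : (klRatio (channel k) (inPmf (wstar k)) (inPmf w) : EReal) ≤
      contractionCoeff (channel k) (inPmf (wstar k)) :=
    le_iSup (fun p : {p : Fin 3 → ℝ // p ∈ stdSimplex ℝ (Fin 3) ∧ p ≠ inPmf (wstar k)} =>
      (klRatio (channel k) (inPmf (wstar k)) p.1 : EReal)) ⟨inPmf w, inPmf_mem_stdSimplex hw, hne⟩
  rw [hconj.2, EReal.coe_le_coe_iff, klRatio, div_le_iff₀
    (kl_pos (inPmf_mem_stdSimplex hw) (inPmf_mem_stdSimplex (wstar_mem_domain hk))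
      (inPmf_wstar_pos hk) hne)] at h1
  exact h1

/-- Below the threshold `φ₂` dominates a positive multiple of the divergence of the input laws. -/
lemma exists_mul_kl_le_phi2 (hk : 3 < k) (hd : 1 < d) (hconj : ContractionConjecture k)
    (hdk : (d : ℝ) < dstar k) :
    ∃ ε > 0, ∀ w ∈ domain, ε * kl (inPmf w) (inPmf (wstar k)) ≤ phi2 k d w := by
  refine ⟨_, sub_pos.mpr (coefficient_lt hk hd hdk), fun w hw => ?_⟩
  have h := kl_outPmf_le hk hconj hw
  have hd' : (0 : ℝ) < (d : ℝ) - 1 := sub_pos.mpr (by exact_mod_cast hd)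
  rw [phi2]
  nlinarith

lemma phi2_wstar : phi2 k d (wstar k) = 0 := by
  simp [phi2, kl_self]

lemma phi2_pos (hk : 3 < k) (hd : 1 < d) (hconj : ContractionConjecture k)
    (hdk : (d : ℝ) < dstar k) {w : Fin 2 → ℝ} (hw : w ∈ domain) (hne : w ≠ wstar k) :
    0 < phi2 k d w := by
  obtain ⟨ε, hε, h⟩ := exists_mul_kl_le_phi2 hk hd hconj hdk
  refine lt_of_lt_of_le (mul_pos hε ?_) (h w hw)
  exact kl_pos (inPmf_mem_stdSimplex hw) (inPmf_mem_stdSimplex (wstar_mem_domain hk))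
    (inPmf_wstar_pos hk) fun h' => hne (inPmf_injective h')

end Constants

/-! ### The Hessian -/

section Hessian

variable {ι : Type*} [Fintype ι]

lemma hasDerivAt_kl_line {a b c : ι → ℝ} (ha : ∀ i, 0 < a i) (hc : ∀ i, 0 < c i) :
    HasDerivAt (fun t : ℝ => kl (fun i => a i + t * b i) c)
      (∑ i, b i * (Real.log (a i / c i) + 1)) 0 := by
  unfold kl
  refine HasDerivAt.fun_sum fun i _ => ?_
  have h1 : HasDerivAt (fun t : ℝ => a i + t * b i) (b i) 0 := by
    simpa using ((hasDerivAt_id (0 : ℝ)).mul_const (b i)).const_add (a i)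
  have h2 := h1.mul ((h1.div_const (c i)).log (by
    simpa using (div_pos (ha i) (hc i)).ne'))
  refine h2.congr_deriv ?_
  have := (ha i).ne'
  have := (hc i).ne'
  simp
  field_simp

lemma hasDerivAt_log_line {a b c : ι → ℝ} (e : ι → ℝ) (ha : ∀ i, 0 < a i) (hc : ∀ i, 0 < c i) :
    HasDerivAt (fun t : ℝ => ∑ i, e i * (Real.log ((a i + t * b i) / c i) + 1))
      (∑ i, e i * b i / a i) 0 := by
  refine HasDerivAt.fun_sum fun i _ => ?_
  have h1 : HasDerivAt (fun t : ℝ => a i + t * b i) (b i) 0 := by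
    simpa using ((hasDerivAt_id (0 : ℝ)).mul_const (b i)).const_add (a i)
  have h2 := (((h1.div_const (c i)).log (by
    simpa using (div_pos (ha i) (hc i)).ne')).add_const 1).const_mul (e i)
  refine h2.congr_deriv ?_
  have := (ha i).ne'
  have := (hc i).ne'
  simp
  field_simp

end Hessian

/-- The linear part of the affine map `inPmf`. -/
def inDir (v : Fin 2 → ℝ) : Fin 3 → ℝ := ![-2 * v 0 + v 1, 2 * (v 0 - v 1), v 1]

/-- The linear part of the affine map `outPmf k`. -/
noncomputable def outDir (k : ℕ) (v : Fin 2 → ℝ) : Fin 3 → ℝ := (channel k).mulVec (inDir v)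

lemma inPmf_add_smul (y v : Fin 2 → ℝ) (t : ℝ) :
    inPmf (y + t • v) = fun i => inPmf y i + t * inDir v i := by
  funext i
  fin_cases i <;> simp [inPmf, inDir] <;> ring

lemma outPmf_add_smul (k : ℕ) (y v : Fin 2 → ℝ) (t : ℝ) :
    outPmf k (y + t • v) = fun i => outPmf k y i + t * outDir k v i := by
  have : inPmf (y + t • v) = inPmf y + t • inDir v := inPmf_add_smul y v t
  rw [outPmf, this, Matrix.mulVec_add, Matrix.mulVec_smul]
  rfl

lemma outPmf_eq (k : ℕ) (w : Fin 2 → ℝ) :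
    outPmf k w = ![1 - 2 * w1star k + w1star k * w 0, 2 * w1star k * (1 - w 0),
      w1star k * w 0] := by
  funext i
  fin_cases i <;> simp [outPmf, channel, inPmf, Matrix.mulVec, dotProduct, Fin.sum_univ_three] <;>
    ring

lemma outPmf_wstar_pos {k : ℕ} (hk : 3 < k) (i : Fin 3) : 0 < outPmf k (wstar k) i := by
  have h0 := w1star_pos hk
  have h1 := w1star_lt_one hk
  rw [outPmf_eq]
  fin_cases i
  · simp [wstar]; nlinarith [mul_pos (sub_pos.mpr h1) (sub_pos.mpr h1)]
  · simp [wstar, h0, h1]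
  · simp [wstar, h0]

lemma lineDeriv_phi2 {k d : ℕ} (hk : 3 < k) {y : Fin 2 → ℝ} (hp : ∀ i, 0 < inPmf y i)
    (hq : ∀ i, 0 < outPmf k y i) (v : Fin 2 → ℝ) :
    lineDeriv ℝ (phi2 k d) y v =
      (d : ℝ) / k * ∑ i, inDir v i * (Real.log (inPmf y i / inPmf (wstar k) i) + 1) -
        ((d : ℝ) - 1) *
          ∑ i, outDir k v i * (Real.log (outPmf k y i / outPmf k (wstar k) i) + 1) := by
  rw [lineDeriv]
  simp only [phi2, inPmf_add_smul, outPmf_add_smul]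
  exact (((hasDerivAt_kl_line hp (inPmf_wstar_pos hk)).const_mul _).sub
    ((hasDerivAt_kl_line hq (outPmf_wstar_pos hk)).const_mul _)).deriv

lemma hessian_phi2_apply {k d : ℕ} (hk : 3 < k) (i j : Fin 2) :
    hessian (phi2 k d) (wstar k) i j =
      (d : ℝ) / k * ∑ s, inDir (Pi.single j 1) s * inDir (Pi.single i 1) s / inPmf (wstar k) s -
        ((d : ℝ) - 1) *
          ∑ s, outDir k (Pi.single j 1) s * outDir k (Pi.single i 1) s / outPmf k (wstar k) s := by
  rw [hessian, Matrix.of_apply, lineDeriv]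
  have hpos : ∀ {ι : Type} [Fintype ι] (a b : ι → ℝ), (∀ s, 0 < a s) →
      ∀ᶠ t in 𝓝 (0 : ℝ), ∀ s, 0 < a s + t * b s := fun a b ha => by
    rw [Filter.eventually_all]
    intro s
    have : ContinuousAt (fun t : ℝ => a s + t * b s) 0 := by fun_prop
    exact this.eventually (lt_mem_nhds (by simpa using ha s))
  have h := ((hasDerivAt_log_line (b := inDir (Pi.single i 1)) (inDir (Pi.single j 1))
    (inPmf_wstar_pos hk) (inPmf_wstar_pos hk)).const_mul ((d : ℝ) / k)).sub
    ((hasDerivAt_log_line (b := outDir k (Pi.single i 1)) (outDir k (Pi.single j 1))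
    (outPmf_wstar_pos hk) (outPmf_wstar_pos hk)).const_mul ((d : ℝ) - 1))
  refine (h.congr_of_eventuallyEq ?_).deriv
  filter_upwards [hpos _ (inDir (Pi.single i 1)) (inPmf_wstar_pos hk),
    hpos _ (outDir k (Pi.single i 1)) (outPmf_wstar_pos hk)] with t h1 h2
  rw [lineDeriv_phi2 hk (by rwa [inPmf_add_smul]) (by rwa [outPmf_add_smul]), inPmf_add_smul,
    outPmf_add_smul]
  rfl

theorem hessian_phi2 {k d : ℕ} (hk : 3 < k) :
    hessian (phi2 k d) (wstar k) =
      !![((d : ℝ) * ((k : ℝ) ^ 2 - k + 2) + (k : ℝ) ^ 2 * ((k : ℝ) - 3)) /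
            (((k : ℝ) - 2) ^ 2 * ((k : ℝ) - 3)),
          -((d : ℝ) * ((k : ℝ) - 1) ^ 2 / (((k : ℝ) - 2) * ((k : ℝ) - 3)));
         -((d : ℝ) * ((k : ℝ) - 1) ^ 2 / (((k : ℝ) - 2) * ((k : ℝ) - 3))),
          (d : ℝ) * ((k : ℝ) - 1) ^ 2 / (2 * ((k : ℝ) - 3))] := by
  have h3 : (3 : ℝ) < k := by exact_mod_cast hk
  have e0 : (k : ℝ) ≠ 0 := by linarith
  have e1 : (k : ℝ) - 1 ≠ 0 := by linarith
  have e2 : (k : ℝ) - 2 ≠ 0 := by linarith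
  have e3 : (k : ℝ) - 3 ≠ 0 := by linarith
  have hout : outPmf k (wstar k) = ![((k : ℝ) - 2) ^ 2 / k ^ 2, 4 * ((k : ℝ) - 2) / k ^ 2,
      4 / (k : ℝ) ^ 2] := by
    rw [outPmf_eq]
    funext i
    fin_cases i <;> simp [wstar, w1star] <;> field_simp <;> ring
  have hdir : ∀ v, outDir k v = ![2 / k * v 0, -(4 / k * v 0), 2 / k * v 0] := fun v => by
    funext i
    fin_cases i <;>
      simp [outDir, channel, inDir, Matrix.mulVec, dotProduct, Fin.sum_univ_three, w1star] <;> ring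
  ext i j
  rw [hessian_phi2_apply hk, hout, inPmf_wstar hk]
  simp only [hdir, Fin.sum_univ_three]
  fin_cases i <;> fin_cases j <;> simp [inDir] <;> field_simp <;> ring

lemma laplaceConstant_eq {k d : ℕ} (hk : 3 < k) (hd : 1 < d) :
    laplaceConstant k d = √(((k : ℝ) - 1) / ((k : ℝ) - d)) := by
  have h3 : (3 : ℝ) < k := by exact_mod_cast hk
  have hd0 : (0 : ℝ) < d := by positivity
  have e0 : (k : ℝ) ≠ 0 := by linarith
  have e1 : (k : ℝ) - 1 ≠ 0 := by linarith
  have e2 : (k : ℝ) - 2 ≠ 0 := by linarith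
  have e3 : (k : ℝ) - 3 ≠ 0 := by linarith
  have hprod : ∏ i, inPmf (wstar k) i =
      8 * ((k : ℝ) - 2) ^ 2 * (k - 3) / (k ^ 3 * (k - 1) ^ 3) := by
    rw [inPmf_wstar hk, Fin.prod_univ_three]
    simp
    field_simp
    ring
  have hdet : (((k : ℝ) / √(2 * d)) • hessian (phi2 k d) (wstar k)).det =
      k ^ 3 * (k - 1) ^ 2 / (4 * (k - 2) ^ 2 * (k - 3)) * (k - d) := by
    rw [Matrix.det_smul, hessian_phi2 hk, Matrix.det_fin_two, Fintype.card_fin, div_pow,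
      Real.sq_sqrt (by positivity)]
    simp
    field_simp
    ring
  have hpos : 0 < ∏ i, inPmf (wstar k) i := Finset.prod_pos fun i _ => inPmf_wstar_pos hk i
  rw [laplaceConstant, ← Real.sqrt_mul (by positivity), hdet, hprod]
  congr 1
  rcases eq_or_ne ((k : ℝ) - d) 0 with h | h
  · rw [h]
    simp
  · field_simp
    ring

/-! ### A Gaussian bound for the terms -/

lemma overlapTerm_nonneg {k d n m l : ℕ} (hk : 3 < k) (hd : 0 < d) (hn : 0 < n) (hm : 0 < m)
    (hln : l < n) (r s : ℤ) : 0 ≤ overlapTerm k d n m l r s := by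
  have hq := cellPmf_pos (w1star_pos hk) (w1star_lt_one hk)
  have hp := inPmf_wstar_pos hk
  have hnl : 0 < n - l := by omega
  have h : ∀ {x : ℝ}, 0 < x → ∀ a, 0 ≤ poissonWeight x a := fun hx a => poissonWeight_nonneg hx a
  unfold overlapTerm
  refine mul_nonneg (div_nonneg (Finset.prod_nonneg fun t _ => h ?_ _) (h ?_ _))
    (mul_nonneg (Finset.prod_nonneg fun c _ => div_nonneg (h ?_ _) (h ?_ _))
      (mul_nonneg (sq_nonneg _) (div_nonneg (h ?_ _) (h ?_ _))))
  · have := hp t; positivity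
  · positivity
  · have := hq c; positivity
  · have := hq c; positivity
  · positivity
  · positivity

lemma overlapTerm_eq_zero_of_overlapCount {k d n m l : ℕ} {r s : ℤ} {c : Bool × Bool}
    (hc : overlapCount n l r c < 0) : overlapTerm k d n m l r s = 0 := by
  rw [overlapTerm, Finset.prod_eq_zero (s := Finset.univ) (i := c)
    (f := fun c => poissonWeight (n * cellPmf (w1star k) c) (overlapCount n l r c) /
      poissonWeight (d * (n * cellPmf (w1star k) c)) (d * overlapCount n l r c))
    (Finset.mem_univ c) (by rw [poissonWeight_of_neg _ hc, zero_div])]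
  ring

lemma overlapTerm_eq_zero_of_typeCount {k d n m l : ℕ} {r s : ℤ} {t : Fin 3}
    (ht : typeCount m (d * r) s t < 0) : overlapTerm k d n m l r s = 0 := by
  rw [overlapTerm, Finset.prod_eq_zero (s := Finset.univ) (i := t)
    (f := fun t => poissonWeight (m * inPmf (wstar k) t) (typeCount m (d * r) s t))
    (Finset.mem_univ t) (poissonWeight_of_neg _ ht)]
  simp

lemma overlapTerm_eq_zero_of_notMem {k d n m l : ℕ} (hln : l ≤ n) {r s : ℤ}
    (h : ¬(r ∈ Finset.Icc (0 : ℤ) n ∧ s ∈ Finset.Icc (0 : ℤ) m)) :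
    overlapTerm k d n m l r s = 0 := by
  by_contra h0
  have h1 : ∀ c, 0 ≤ overlapCount n l r c := fun c => by
    by_contra hc
    exact h0 (overlapTerm_eq_zero_of_overlapCount (not_le.mp hc))
  have h2 : ∀ t, 0 ≤ typeCount m (d * r) s t := fun t => by
    by_contra hc
    exact h0 (overlapTerm_eq_zero_of_typeCount (not_le.mp hc))
  have h3 := h1 (true, true)
  have h4 := h1 (true, false)
  have h5 := h2 0
  have h6 := h2 1
  have h7 := h2 2
  simp [overlapCount, typeCount] at h3 h4 h5 h6 h7
  simp only [Finset.mem_Icc] at h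
  omega

/-- The bound of a term by Stirling's formula: the exponent is the cost of the constraint types
minus `d - 1` times the cost of the variable types, and only the types of the constraints contribute
a polynomial factor. -/
lemma overlapTerm_le {k d n m l : ℕ} (hk : 3 < k) (hd : 0 < d) (hn : 0 < n) (hm : 0 < m)
    (hl : 0 < l) (hln : l < n) {r s : ℤ} (hα : ∀ c, 0 ≤ overlapCount n l r c)
    (hβ : ∀ t, 0 ≤ typeCount m (d * r) s t) :
    overlapTerm k d n m l r s ≤
      Real.exp 1 * (Real.exp 1 * √d) ^ 4 * ((Real.exp 1 * Real.exp 1) ^ 2 * (Real.exp 1 * √d)) *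
        (√((m : ℝ) + 1) * ∏ t, (√((typeCount m (d * r) s t : ℝ) + 1))⁻¹) *
        Real.exp (-(∑ t, poissonCost (m * inPmf (wstar k) t) (typeCount m (d * r) s t) -
          ((d : ℝ) - 1) * ∑ c, poissonCost (n * cellPmf (w1star k) c) (overlapCount n l r c))) := by
  have hq := cellPmf_pos (w1star_pos hk) (w1star_lt_one hk)
  have hp := inPmf_wstar_pos hk
  have hnl : 0 < n - l := by omega
  have hm' : (0 : ℝ) < m := by positivity
  have hn' : (0 : ℝ) < n := by positivity
  have b1 : (∏ t, poissonWeight (m * inPmf (wstar k) t) (typeCount m (d * r) s t)) ≤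
      Real.exp (-∑ t, poissonCost (m * inPmf (wstar k) t) (typeCount m (d * r) s t)) *
        ∏ t, (√((typeCount m (d * r) s t : ℝ) + 1))⁻¹ := by
    rw [← Finset.sum_neg_distrib, Real.exp_sum, ← Finset.prod_mul_distrib]
    refine Finset.prod_le_prod (fun t _ => poissonWeight_nonneg (mul_pos hm' (hp t)) _) fun t _ => ?_
    rw [← div_eq_mul_inv]
    exact poissonWeight_le (mul_pos hm' (hp t)) (hβ t)
  have b2 : (poissonWeight m m)⁻¹ ≤ Real.exp 1 * √((m : ℝ) + 1) := by
    have := le_poissonWeight hm' (a := (m : ℤ)) (by positivity)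
    rw [Int.cast_natCast, poissonCost_self hm', neg_zero, Real.exp_zero, one_div] at this
    exact inv_le_of_inv_le₀ (by positivity) this
  have b3 : (∏ c, poissonWeight (n * cellPmf (w1star k) c) (overlapCount n l r c) /
      poissonWeight (d * (n * cellPmf (w1star k) c)) (d * overlapCount n l r c)) ≤
      (Real.exp 1 * √d) ^ 4 * Real.exp (((d : ℝ) - 1) *
        ∑ c, poissonCost (n * cellPmf (w1star k) c) (overlapCount n l r c)) := by
    have : (Real.exp 1 * √d) ^ 4 = ∏ _c : Bool × Bool, (Real.exp 1 * √d) := by simp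
    rw [Finset.mul_sum, Real.exp_sum, this, ← Finset.prod_mul_distrib]
    refine Finset.prod_le_prod (fun c _ => ?_) fun c _ => ?_
    · have := mul_pos hn' (hq c)
      exact div_nonneg (poissonWeight_nonneg this _) (poissonWeight_nonneg (by positivity) _)
    · exact poissonWeight_div_le (mul_pos hn' (hq c)) hd (hα c)
  have b4 := poissonWeight_mul_div_le hd hl
  have b5 := poissonWeight_mul_div_le hd hnl
  have b6 := poissonWeight_div_le hn' hd (a := (n : ℤ)) (by positivity)
  rw [Int.cast_natCast, poissonCost_self hn', mul_zero, Real.exp_zero, mul_one] at b6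
  have p1 : ∀ a : ℕ, 0 < a → 0 < poissonWeight a a := fun a ha =>
    poissonWeight_pos (by positivity) (by positivity)
  have p2 : ∀ a : ℕ, 0 < a → 0 < poissonWeight (d * a) (d * a) := fun a ha =>
    poissonWeight_pos (by positivity) (by positivity)
  have n3 : 0 ≤ ∏ c, poissonWeight (n * cellPmf (w1star k) c) (overlapCount n l r c) /
      poissonWeight (d * (n * cellPmf (w1star k) c)) (d * overlapCount n l r c) :=
    Finset.prod_nonneg fun c _ => by
      have := mul_pos hn' (hq c)
      exact div_nonneg (poissonWeight_nonneg this _) (poissonWeight_nonneg (by positivity) _)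
  have n1 : 0 ≤ ∏ t, (√((typeCount m (d * r) s t : ℝ) + 1))⁻¹ :=
    Finset.prod_nonneg fun _ _ => by positivity
  have q1 := p1 l hl
  have q2 := p1 _ hnl
  have q3 := p1 n hn
  have q4 := p2 l hl
  have q5 := p2 _ hnl
  have q6 := p2 n hn
  have q7 := p1 m hm
  rw [overlapTerm, div_eq_mul_inv]
  calc _ ≤ (Real.exp (-∑ t, poissonCost (m * inPmf (wstar k) t) (typeCount m (d * r) s t)) *
        ∏ t, (√((typeCount m (d * r) s t : ℝ) + 1))⁻¹) * (Real.exp 1 * √((m : ℝ) + 1)) *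
        (((Real.exp 1 * √d) ^ 4 * Real.exp (((d : ℝ) - 1) *
          ∑ c, poissonCost (n * cellPmf (w1star k) c) (overlapCount n l r c))) *
        ((Real.exp 1 * Real.exp 1) ^ 2 * (Real.exp 1 * √d))) := by
        gcongr
    _ = _ := by
        rw [neg_sub, Real.exp_sub, Real.exp_neg]
        ring

/-- A point far from its mean pays for the missing square root factor of Stirling's formula. -/
lemma exists_sqrt_div_mul_exp_le {p c : ℝ} (hp : 0 < p) (hc : 0 < c) :
    ∃ C > 0, ∀ m b : ℝ, 0 < m → 0 ≤ b →
      √(m + 1) * (√(b + 1))⁻¹ * Real.exp (-(c * ((b - m * p) ^ 2 / m))) ≤ C := by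
  refine ⟨(2 / p + 1) + (1 + 4 / (c * p ^ 2)), by positivity, fun m b hm hb => ?_⟩
  have hsq : ∀ {x : ℝ}, 1 ≤ x → √x ≤ x := fun hx => by
    rw [Real.sqrt_le_left (by linarith)]
    nlinarith
  have h4 : 0 < 4 / (c * p ^ 2) := by positivity
  have h2 : 0 < 2 / p := by positivity
  rcases le_total (m * p / 2) b with h | h
  · have h1 : √(m + 1) * (√(b + 1))⁻¹ ≤ 2 / p + 1 := by
      rw [← div_eq_mul_inv, ← Real.sqrt_div (by positivity)]
      refine (Real.sqrt_le_sqrt ?_).trans (hsq (by linarith))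
      rw [div_le_iff₀ (by positivity)]
      have : m ≤ 2 / p * b := by
        rw [div_mul_eq_mul_div, le_div_iff₀ hp]
        linarith
      nlinarith
    have h3 : Real.exp (-(c * ((b - m * p) ^ 2 / m))) ≤ 1 :=
      Real.exp_le_one_iff.mpr (neg_nonpos.mpr (by positivity))
    have := mul_le_mul h1 h3 (Real.exp_pos _).le (by positivity)
    linarith
  · have h1 : c * m * p ^ 2 / 4 ≤ c * ((b - m * p) ^ 2 / m) := by
      have : m * p ^ 2 / 4 ≤ (b - m * p) ^ 2 / m := by
        rw [le_div_iff₀ hm]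
        nlinarith [mul_pos hm hp]
      calc _ = c * (m * p ^ 2 / 4) := by ring
        _ ≤ _ := by gcongr
    have h3 : Real.exp (-(c * ((b - m * p) ^ 2 / m))) ≤ (1 + c * m * p ^ 2 / 4)⁻¹ := by
      rw [Real.exp_neg]
      gcongr
      linarith [Real.add_one_le_exp (c * ((b - m * p) ^ 2 / m))]
    have h5 : √(m + 1) * (√(b + 1))⁻¹ ≤ m + 1 := by
      calc _ ≤ (m + 1) * 1 := by
            gcongr
            · exact hsq (by linarith)
            · exact inv_le_one_of_one_le₀ (Real.one_le_sqrt.mpr (by linarith))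
        _ = _ := mul_one _
    have h6 : (m + 1) * (1 + c * m * p ^ 2 / 4)⁻¹ ≤ 1 + 4 / (c * p ^ 2) := by
      rw [← div_eq_mul_inv, div_le_iff₀ (by positivity)]
      have : (1 + 4 / (c * p ^ 2)) * (1 + c * m * p ^ 2 / 4) =
          m + 1 + c * m * p ^ 2 / 4 + 4 / (c * p ^ 2) := by
        field_simp
        ring
      rw [this]
      have : 0 < c * m * p ^ 2 / 4 := by positivity
      linarith
    have := mul_le_mul h5 h3 (Real.exp_pos _).le (by positivity)
    linarith

lemma sqrt_mul_prod_mul_exp_le {m : ℝ} (hm : 0 < m) (b p : Fin 3 → ℝ) (c : ℝ) {B : Fin 3 → ℝ}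
    (h : ∀ t, √(m + 1) * (√(b t + 1))⁻¹ * Real.exp (-(c * ((b t - m * p t) ^ 2 / m))) ≤ B t) :
    (√(m + 1) * ∏ t, (√(b t + 1))⁻¹) * Real.exp (-(c * ∑ t, (b t - m * p t) ^ 2 / m)) ≤
      (m + 1)⁻¹ * ∏ t, B t := by
  have h2 : (√(m + 1) * ∏ t, (√(b t + 1))⁻¹) * Real.exp (-(c * ∑ t, (b t - m * p t) ^ 2 / m)) =
      (m + 1)⁻¹ * ∏ t, (√(m + 1) * (√(b t + 1))⁻¹ *
        Real.exp (-(c * ((b t - m * p t) ^ 2 / m)))) := by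
    rw [Finset.prod_mul_distrib, Finset.prod_mul_distrib, ← Real.exp_sum,
      Finset.sum_neg_distrib, ← Finset.mul_sum, Finset.prod_const, Finset.card_univ,
      Fintype.card_fin, pow_succ, Real.sq_sqrt (by positivity)]
    field_simp
  rw [h2]
  exact mul_le_mul_of_nonneg_left
    (Finset.prod_le_prod (fun t _ => by positivity) fun t _ => h t) (by positivity)

section Balanced

variable {k d n m l : ℕ} {r s : ℤ}

lemma mul_inPmf_eq_typeCount (hm0 : 0 < m) (hl0 : 0 < l) (hdl : d * l = 2 * m) (t : Fin 3) :
    (m : ℝ) * inPmf ![r / l, s / m] t = typeCount m (d * r) s t := by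
  have hm' : (0 : ℝ) < m := by positivity
  have hl' : (0 : ℝ) < l := by positivity
  have hdl' : (d : ℝ) * l = 2 * m := by exact_mod_cast hdl
  have hr : (m : ℝ) * (2 * (r / l)) = d * r := by
    field_simp
    linear_combination -(r : ℝ) * hdl'
  have hs : (m : ℝ) * (s / m) = s := by field_simp
  fin_cases t
  · simp [typeCount, inPmf]
    linear_combination hs - hr
  · simp [typeCount, inPmf]
    linear_combination hr - 2 * hs
  · simp [typeCount, inPmf]
    linear_combination hs

/-- The cost of the constraint types is the divergence of the input laws. -/
lemma sum_poissonCost_typeCount (hm0 : 0 < m) (hl0 : 0 < l) (hdl : d * l = 2 * m) :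
    ∑ t, poissonCost (m * inPmf (wstar k) t) (typeCount m (d * r) s t) =
      m * kl (inPmf ![r / l, s / m]) (inPmf (wstar k)) := by
  have hm' : (0 : ℝ) < m := by positivity
  have hp : ∀ w, ∑ t, inPmf w t = 1 := fun w => by simp [inPmf, Fin.sum_univ_three]; ring
  rw [kl_eq_sum_poissonCost ((hp _).trans (hp _).symm), Finset.mul_sum]
  refine Finset.sum_congr rfl fun t _ => ?_
  rw [← poissonCost_mul hm', mul_inPmf_eq_typeCount hm0 hl0 hdl]

/-- The cost of the variable types is the divergence of the output laws. -/
lemma sum_poissonCost_overlapCount (hk : 3 < k) (hn : 0 < n) (hl0 : 0 < l)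
    (hl : k * l = 2 * n) :
    ∑ c, poissonCost (n * cellPmf (w1star k) c) (overlapCount n l r c) =
      n * kl (outPmf k ![r / l, s / m]) (outPmf k (wstar k)) := by
  have hn' : (0 : ℝ) < n := by positivity
  have hl' : (0 : ℝ) < l := by positivity
  have hk' : (0 : ℝ) < k := by positivity
  have hl2 : (k : ℝ) * l = 2 * n := by exact_mod_cast hl
  have hw : (n : ℝ) * w1star k = l := by
    rw [w1star]
    field_simp
    linarith
  have hq : ∀ w, ∑ t, outPmf k w t = 1 := fun w => by
    simp [outPmf_eq, Fin.sum_univ_three]; ring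
  rw [kl_eq_sum_poissonCost ((hq _).trans (hq _).symm), Finset.mul_sum, Fin.sum_univ_three]
  simp only [← poissonCost_mul hn', Fintype.sum_prod_type, Fintype.sum_bool]
  have hr : (n : ℝ) * (w1star k * (r / l)) = r := by
    rw [← mul_assoc, hw]
    field_simp
  have e0 : (n : ℝ) * outPmf k ![r / l, s / m] 0 = overlapCount n l r (false, false) := by
    simp [outPmf_eq, overlapCount]
    linear_combination hr - 2 * hw
  have e1 : (n : ℝ) * outPmf k ![r / l, s / m] 1 = 2 * overlapCount n l r (true, false) := by
    simp [outPmf_eq, overlapCount]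
    linear_combination -2 * hr + 2 * hw
  have e2 : (n : ℝ) * outPmf k ![r / l, s / m] 2 = overlapCount n l r (true, true) := by
    simp [outPmf_eq, overlapCount]
    linear_combination hr
  have f0 : outPmf k (wstar k) 0 = cellPmf (w1star k) (false, false) := by
    simp [outPmf_eq, cellPmf, bernoulliPmf, wstar]
    ring
  have f1 : outPmf k (wstar k) 1 = 2 * cellPmf (w1star k) (true, false) := by
    simp [outPmf_eq, cellPmf, bernoulliPmf, wstar]
    ring
  have f2 : outPmf k (wstar k) 2 = cellPmf (w1star k) (true, true) := by
    simp [outPmf_eq, cellPmf, bernoulliPmf, wstar]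
  have f3 : cellPmf (w1star k) (false, true) = cellPmf (w1star k) (true, false) := mul_comm _ _
  rw [e0, e1, e2, f0, f1, f2, f3, mul_left_comm (n : ℝ) 2, poissonCost_mul two_pos]
  simp only [overlapCount, cond_true, cond_false]
  ring

lemma mem_domain_of_counts_nonneg (hm0 : 0 < m) (hl0 : 0 < l) (hd : 0 < d) (hdl : d * l = 2 * m)
    (hα : ∀ c, 0 ≤ overlapCount n l r c) (hβ : ∀ t, 0 ≤ typeCount m (d * r) s t) :
    (![r / l, s / m] : Fin 2 → ℝ) ∈ domain := by
  have hm' : (0 : ℝ) < m := by positivity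
  have hl' : (0 : ℝ) < l := by positivity
  have hd' : (0 : ℝ) < d := by positivity
  have hdl' : (d : ℝ) * l = 2 * m := by exact_mod_cast hdl
  have a1 : (0 : ℝ) ≤ r := by exact_mod_cast hα (true, true)
  have a2 : (0 : ℝ) ≤ l - r := by exact_mod_cast hα (true, false)
  have b0 : (0 : ℝ) ≤ m + s - d * r := by exact_mod_cast hβ 0
  have b1 : (0 : ℝ) ≤ d * r - 2 * s := by exact_mod_cast hβ 1
  have b2 : (0 : ℝ) ≤ s := by exact_mod_cast hβ 2
  have hr : (r : ℝ) / l = d * r / (2 * m) := by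
    rw [← hdl']
    field_simp
  have hdr : (d : ℝ) * r ≤ 2 * m := by
    rw [← hdl']
    nlinarith
  refine ⟨fun i => ?_, ?_, ?_⟩
  · fin_cases i
    · change (r : ℝ) / l ∈ Set.Icc (0 : ℝ) 1
      exact ⟨by positivity, by rw [div_le_one hl']; linarith⟩
    · change (s : ℝ) / m ∈ Set.Icc (0 : ℝ) 1
      exact ⟨by positivity, by rw [div_le_one hm']; linarith⟩
  · simp only [Matrix.cons_val_zero, Matrix.cons_val_one, hr]
    rw [sub_le_iff_le_add, ← mul_div_assoc, div_add_one hm'.ne', div_le_div_iff₀ (by positivity) hm']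
    nlinarith
  · simp only [Matrix.cons_val_zero, Matrix.cons_val_one, hr]
    rw [div_le_div_iff₀ hm' (by positivity)]
    nlinarith

/-- The deviations of the constraint types from their means control those of the two summation
variables. -/
lemma sum_sq_deviation_ge (hk : 0 < k) (hd : 0 < d) (hn : 0 < n) (hm0 : 0 < m)
    (hm : d * n = k * m) (r : ℤ) :
    k / (6 * d) * (((r - n * w1star k ^ 2) ^ 2 + (s - m * w2star k) ^ 2) / n) ≤
      ∑ t, ((typeCount m (d * r) s t : ℝ) - m * inPmf (wstar k) t) ^ 2 / m := by
  have hk' : (0 : ℝ) < k := by positivity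
  have hd' : (0 : ℝ) < d := by positivity
  have hn' : (0 : ℝ) < n := by positivity
  have hm' : (0 : ℝ) < m := by positivity
  have hmr : (d : ℝ) * n = k * m := by exact_mod_cast hm
  have e1 : ((typeCount m (d * r) s 1 : ℤ) : ℝ) = d * r - 2 * s := by simp [typeCount]
  have e2 : ((typeCount m (d * r) s 2 : ℤ) : ℝ) = s := by simp [typeCount]
  have e3 : inPmf (wstar k) 1 = 2 * (w1star k - w2star k) := rfl
  have e4 : inPmf (wstar k) 2 = w2star k := rfl
  rw [Fin.sum_univ_three, e1, e2, e3, e4]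
  have h0 : 0 ≤ ((typeCount m (d * r) s 0 : ℝ) - m * inPmf (wstar k) 0) ^ 2 / m := by positivity
  generalize ((typeCount m (d * r) s 0 : ℝ) - m * inPmf (wstar k) 0) ^ 2 / m = X at h0 ⊢
  have hR : (d : ℝ) * (r - n * w1star k ^ 2) =
      (d * r - 2 * s - m * (2 * (w1star k - w2star k))) + 2 * (s - m * w2star k) := by
    have : (m : ℝ) = n * (d / k) := by field_simp; linarith
    rw [this, w1star]
    field_simp
    ring
  generalize (d * r - 2 * s - m * (2 * (w1star k - w2star k)) : ℝ) = A at hR ⊢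
  generalize (s - m * w2star k : ℝ) = S at hR ⊢
  generalize (r - n * w1star k ^ 2 : ℝ) = R at hR ⊢
  have hR2 : R ^ 2 ≤ 5 * (A ^ 2 + S ^ 2) := by
    have h2 : ((d : ℝ) * R) ^ 2 ≤ 5 * (A ^ 2 + S ^ 2) := by
      rw [hR]
      nlinarith [sq_nonneg (2 * A - S)]
    have h3 : (1 : ℝ) ≤ d ^ 2 := one_le_pow₀ (by exact_mod_cast hd)
    rw [mul_pow] at h2
    nlinarith [sq_nonneg R]
  have h4 : k / (6 * d) * ((R ^ 2 + S ^ 2) / n) = (R ^ 2 + S ^ 2) / (6 * m) := by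
    have : (n : ℝ) = k * m / d := by field_simp; linarith
    rw [this]
    field_simp
  have h5 : (R ^ 2 + S ^ 2) / (6 * m) ≤ A ^ 2 / m + S ^ 2 / m := by
    rw [← add_div, div_le_div_iff₀ (by positivity) hm']
    nlinarith [sq_nonneg A, mul_nonneg hm'.le (sq_nonneg A)]
  linarith

end Balanced

/-- The contraction inequality turns Stirling's bound into a Gaussian one that is uniform in all
terms. -/
theorem exists_overlapTerm_le_gaussian {k d : ℕ} (hk : 3 < k) (hd : 1 < d)
    (hconj : ContractionConjecture k) (hdk : (d : ℝ) < dstar k) :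
    ∃ C > 0, ∃ c > 0, ∀ n m l : ℕ, 0 < n → d * n = k * m → k * l = 2 * n → ∀ r s : ℤ,
      n * overlapTerm k d n m l r s ≤ C * Real.exp (-(c *
        (((r - n * w1star k ^ 2) ^ 2 + (s - m * w2star k) ^ 2) / n))) := by
  obtain ⟨ε, hε, hphi⟩ := exists_mul_kl_le_phi2 hk hd hconj hdk
  have hp := inPmf_wstar_pos hk
  have hk' : (0 : ℝ) < k := by positivity
  have hd0 : 0 < d := by omega
  have hd' : (0 : ℝ) < d := by positivity
  set c₀ : ℝ := k * ε / (8 * d) with hc₀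
  have hc₀' : 0 < c₀ := by positivity
  choose B hB hBle using fun t => exists_sqrt_div_mul_exp_le (hp t) hc₀'
  set C₁ : ℝ := Real.exp 1 * (Real.exp 1 * √d) ^ 4 *
    ((Real.exp 1 * Real.exp 1) ^ 2 * (Real.exp 1 * √d)) with hC₁
  have hBprod : 0 < ∏ t, B t := Finset.prod_pos fun t _ => hB t
  refine ⟨C₁ * (k / d) * ∏ t, B t, by positivity, c₀ * k / (6 * d), by positivity,
    fun n m l hn hm hl r s => ?_⟩
  have hdl : d * l = 2 * m := by
    apply Nat.eq_of_mul_eq_mul_left (show 0 < k by omega)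
    calc k * (d * l) = d * (k * l) := by ring
      _ = 2 * (d * n) := by rw [hl]; ring
      _ = k * (2 * m) := by rw [hm]; ring
  have hl0 : 0 < l := by
    rcases Nat.eq_zero_or_pos l with rfl | h
    · omega
    · exact h
  have hln : l < n := by nlinarith
  have hm0 : 0 < m := by
    rcases Nat.eq_zero_or_pos m with rfl | h
    · have := Nat.mul_pos hd0 hn
      omega
    · exact h
  have hn' : (0 : ℝ) < n := by positivity
  have hm' : (0 : ℝ) < m := by positivity
  have hl' : (0 : ℝ) < l := by positivity
  have hmr : (d : ℝ) * n = k * m := by exact_mod_cast hm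
  by_cases hα : ∀ c, 0 ≤ overlapCount n l r c
  swap
  · push Not at hα
    obtain ⟨c, hc⟩ := hα
    rw [overlapTerm_eq_zero_of_overlapCount hc, mul_zero]
    positivity
  by_cases hβ : ∀ t, 0 ≤ typeCount m (d * r) s t
  swap
  · push Not at hβ
    obtain ⟨t, ht⟩ := hβ
    rw [overlapTerm_eq_zero_of_typeCount ht, mul_zero]
    positivity
  have hdom := mem_domain_of_counts_nonneg hm0 hl0 hd0 hdl hα hβ
  have h1 := overlapTerm_le hk hd0 hn hm0 hl0 hln hα hβ
  rw [sum_poissonCost_typeCount hm0 hl0 hdl,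
    sum_poissonCost_overlapCount (s := s) (m := m) hk hn hl0 hl] at h1
  set D : ℝ := ∑ t, ((typeCount m (d * r) s t : ℝ) - m * inPmf (wstar k) t) ^ 2 / m with hD
  -- the exponent is `-n φ₂ ≤ -2 c₀ D`; one half absorbs the square roots, the other half is the
  -- Gaussian factor of the bound
  have hexp : c₀ * D + c₀ * D ≤ m * kl (inPmf ![r / l, s / m]) (inPmf (wstar k)) -
      ((d : ℝ) - 1) * (n * kl (outPmf k ![r / l, s / m]) (outPmf k (wstar k))) := by
    have h2 := hphi _ hdom
    have h3 := sum_sq_sub_le_kl (inPmf_mem_stdSimplex hdom)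
      (inPmf_mem_stdSimplex (wstar_mem_domain hk)) hp
    have h4 : (m : ℝ) * ∑ t, (inPmf ![r / l, s / m] t - inPmf (wstar k) t) ^ 2 = D := by
      rw [hD, Finset.mul_sum]
      refine Finset.sum_congr rfl fun t _ => ?_
      rw [← mul_inPmf_eq_typeCount hm0 hl0 hdl]
      field_simp
    have h5 : (m : ℝ) * kl (inPmf ![r / l, s / m]) (inPmf (wstar k)) -
        ((d : ℝ) - 1) * (n * kl (outPmf k ![r / l, s / m]) (outPmf k (wstar k))) =
        n * phi2 k d ![r / l, s / m] := by
      have : (m : ℝ) = n * (d / k) := by field_simp; linarith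
      rw [phi2, this]
      ring
    rw [h5]
    have h6 : c₀ * D + c₀ * D = n * (ε *
        ((∑ t, (inPmf ![r / l, s / m] t - inPmf (wstar k) t) ^ 2) / 4)) := by
      have : (n : ℝ) = k * m / d := by field_simp; linarith
      rw [← h4, this, hc₀]
      ring
    rw [h6]
    exact mul_le_mul_of_nonneg_left ((mul_le_mul_of_nonneg_left h3 hε.le).trans h2) hn'.le
  have hpoly := sqrt_mul_prod_mul_exp_le hm' (fun t => ((typeCount m (d * r) s t : ℤ) : ℝ))
    (inPmf (wstar k)) c₀ fun t => hBle t m _ hm' (by exact_mod_cast hβ t)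
  rw [← hD] at hpoly
  have hquad : c₀ * k / (6 * d) *
      (((r - n * w1star k ^ 2) ^ 2 + (s - m * w2star k) ^ 2) / n) ≤ c₀ * D := by
    have h2 := sum_sq_deviation_ge (s := s) (by omega : 0 < k) hd0 hn hm0 hm r
    calc _ = c₀ * (k / (6 * d) *
          (((r - n * w1star k ^ 2) ^ 2 + (s - m * w2star k) ^ 2) / n)) := by ring
      _ ≤ _ := by gcongr
  have hnm : (n : ℝ) * ((m : ℝ) + 1)⁻¹ ≤ k / d := by
    rw [← div_eq_mul_inv, div_le_div_iff₀ (by positivity) hd']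
    nlinarith
  calc (n : ℝ) * overlapTerm k d n m l r s
      ≤ n * (C₁ * (√((m : ℝ) + 1) * ∏ t, (√((typeCount m (d * r) s t : ℝ) + 1))⁻¹) *
        Real.exp (-(c₀ * D + c₀ * D))) := by
        refine mul_le_mul_of_nonneg_left (h1.trans ?_) hn'.le
        have : 0 ≤ ∏ t, (√((typeCount m (d * r) s t : ℝ) + 1))⁻¹ :=
          Finset.prod_nonneg fun _ _ => by positivity
        gcongr
    _ = C₁ * (n * (((√((m : ℝ) + 1) * ∏ t, (√((typeCount m (d * r) s t : ℝ) + 1))⁻¹) *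
        Real.exp (-(c₀ * D))))) * Real.exp (-(c₀ * D)) := by
        rw [neg_add, Real.exp_add]
        ring
    _ ≤ C₁ * (n * (((m : ℝ) + 1)⁻¹ * ∏ t, B t)) * Real.exp (-(c₀ * k / (6 * d) *
        (((r - n * w1star k ^ 2) ^ 2 + (s - m * w2star k) ^ 2) / n))) := by
        gcongr
    _ = C₁ * ((n * ((m : ℝ) + 1)⁻¹) * ∏ t, B t) * Real.exp (-(c₀ * k / (6 * d) *
        (((r - n * w1star k ^ 2) ^ 2 + (s - m * w2star k) ^ 2) / n))) := by
        ring
    _ ≤ C₁ * (k / d * ∏ t, B t) * Real.exp (-(c₀ * k / (6 * d) *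
        (((r - n * w1star k ^ 2) ^ 2 + (s - m * w2star k) ^ 2) / n))) := by
        gcongr
    _ = _ := by ring

/-! ### The pointwise limit of the rescaled terms -/

/-- The number of constraints. -/
def numConstraints (k d n : ℕ) : ℕ := d * n / k

/-- The number of ones in a solution. -/
def numOnes (k n : ℕ) : ℕ := 2 * n / k

lemma mul_numConstraints {k d n : ℕ} (h : n ∈ admissible k d) :
    d * n = k * numConstraints k d n := (Nat.mul_div_cancel' h.2.1).symm

lemma mul_numOnes {k d n : ℕ} (h : n ∈ admissible k d) : k * numOnes k n = 2 * n :=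
  Nat.mul_div_cancel' h.2.2

/-- The lattice point at rescaled position `u` around the centre of the sum. -/
noncomputable def latticePoint (k d n : ℕ) (u : ℝ × ℝ) : ℤ × ℤ :=
  (⌊n * w1star k ^ 2 + √n * u.1⌋, ⌊numConstraints k d n * w2star k + √n * u.2⌋)

lemma tendsto_floor_sub_div (c : ℕ → ℝ) (x : ℝ) :
    Tendsto (fun n : ℕ => ((⌊c n + √n * x⌋ : ℝ) - c n) / √n) atTop (𝓝 x) := by
  have h0 : Tendsto (fun n : ℕ => (√(n : ℝ))⁻¹) atTop (𝓝 0) :=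
    (Real.tendsto_sqrt_atTop.comp tendsto_natCast_atTop_atTop).inv_tendsto_atTop
  rw [tendsto_iff_norm_sub_tendsto_zero]
  refine squeeze_zero' (Eventually.of_forall fun _ => norm_nonneg _) ?_ h0
  filter_upwards [eventually_gt_atTop 0] with n hn
  have hs : 0 < √(n : ℝ) := by positivity
  have h1 := Int.floor_le (c n + √n * x)
  have h2 := Int.lt_floor_add_one (c n + √n * x)
  rw [Real.norm_eq_abs, abs_le, div_sub' hs.ne', le_div_iff₀ hs, div_le_iff₀ hs, neg_mul,
    inv_mul_cancel₀ hs.ne']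
  constructor <;> linarith

/-- The Poisson local limit theorem for a mean proportional to `n`. -/
lemma tendsto_sqrt_mul_poissonWeight_of_linear {F : Filter ℕ} (hF : F ≤ atTop) {l : ℕ → ℝ}
    {a : ℕ → ℤ} {κ y : ℝ} (hκ : 0 < κ) (hl : ∀ᶠ n in F, l n = n * κ)
    (ha : Tendsto (fun n => ((a n : ℝ) - l n) / √n) F (𝓝 y)) :
    Tendsto (fun n => √(l n) * poissonWeight (l n) (a n)) F
      (𝓝 (Real.exp (-(y ^ 2 / (2 * κ))) / √(2 * Real.pi))) := by
  have h1 : Tendsto l F atTop := by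
    refine Tendsto.congr' (EventuallyEq.symm hl) ?_
    exact (tendsto_natCast_atTop_atTop.mono_left hF).atTop_mul_const hκ
  have h2 : Tendsto (fun n => ((a n : ℝ) - l n) / √(l n)) F (𝓝 (y / √κ)) := by
    refine (ha.div_const (√κ)).congr' ?_
    filter_upwards [hl] with n hn
    rw [div_div, ← Real.sqrt_mul (by positivity), hn]
  have h3 := tendsto_sqrt_mul_poissonWeight h1 h2
  have h4 : (y / √κ) ^ 2 / 2 = y ^ 2 / (2 * κ) := by
    rw [div_pow, Real.sq_sqrt hκ.le, div_div, mul_comm κ]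
  rwa [h4] at h3

lemma tendsto_sqrt_mul_poissonWeight_self {F : Filter ℕ} (hF : F ≤ atTop) {l : ℕ → ℝ}
    {a : ℕ → ℤ} {κ : ℝ} (hκ : 0 < κ) (hl : ∀ᶠ n in F, l n = n * κ)
    (ha : ∀ᶠ n in F, (a n : ℝ) = l n) :
    Tendsto (fun n => √(l n) * poissonWeight (l n) (a n)) F (𝓝 (1 / √(2 * Real.pi))) := by
  have h := tendsto_sqrt_mul_poissonWeight_of_linear (y := 0) (a := a) hF hκ hl
    (tendsto_const_nhds.congr' (by
      filter_upwards [ha] with n hn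
      simp [hn]))
  simpa using h

/-- The exponent of the limiting Gaussian density. -/
noncomputable def limitForm (k d : ℕ) (u : ℝ × ℝ) : ℝ :=
  k / (2 * d) * ((u.2 - d * u.1) ^ 2 / inPmf (wstar k) 0 +
    (d * u.1 - 2 * u.2) ^ 2 / inPmf (wstar k) 1 + u.2 ^ 2 / inPmf (wstar k) 2) -
  ((d : ℝ) - 1) / 2 * (u.1 ^ 2 * ∑ c, (cellPmf (w1star k) c)⁻¹)

/-- The normalization of the limiting Gaussian density. -/
noncomputable def limitScale (k d : ℕ) : ℝ :=
  k / d * √d / √(∏ t, inPmf (wstar k) t)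

lemma sqrt_mul_div_sqrt_mul {d x : ℝ} (hd : 0 < d) (hx : 0 < x) (p q : ℝ) :
    √x * p / (√(d * x) * q) = (√d)⁻¹ * (p / q) := by
  rw [Real.sqrt_mul hd.le]
  have := Real.sqrt_pos.mpr hx
  field_simp

lemma sqrt_mul_mul_div_sqrt {d x : ℝ} (hd : 0 < d) (hx : 0 < x) (p q : ℝ) :
    √(d * x) * q / (√x * p) = √d * (q / p) := by
  rw [Real.sqrt_mul hd.le]
  have := Real.sqrt_pos.mpr hx
  field_simp

/-- The powers of the means in the Poisson weights combine to the constant `limitScale`. -/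
lemma mul_overlapTerm_eq {k d n m l : ℕ} (hk : 3 < k) (hd : 0 < d) (hn : 0 < n)
    (hm0 : 0 < m) (hl0 : 0 < l) (hln : l < n) (hm : d * n = k * m) (r s : ℤ) :
    n * overlapTerm k d n m l r s =
      limitScale k d *
      ((∏ t, √(m * inPmf (wstar k) t) *
        poissonWeight (m * inPmf (wstar k) t) (typeCount m (d * r) s t)) /
        (√m * poissonWeight m m)) *
      ((∏ c, √(n * cellPmf (w1star k) c) *
        poissonWeight (n * cellPmf (w1star k) c) (overlapCount n l r c) /
        (√(d * (n * cellPmf (w1star k) c)) *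
          poissonWeight (d * (n * cellPmf (w1star k) c)) (d * overlapCount n l r c))) *
      ((√(d * l) * poissonWeight (d * l) (d * l) / (√l * poissonWeight l l) *
        (√(d * (n - l : ℕ)) * poissonWeight (d * (n - l : ℕ)) (d * (n - l : ℕ)) /
          (√(n - l : ℕ) * poissonWeight (n - l : ℕ) (n - l : ℕ)))) ^ 2 *
        (√n * poissonWeight n n / (√(d * n) * poissonWeight (d * n) (d * n))))) := by
  have hq := cellPmf_pos (w1star_pos hk) (w1star_lt_one hk)
  have hp := inPmf_wstar_pos hk
  have hnl : (0 : ℝ) < (n - l : ℕ) := by exact_mod_cast Nat.sub_pos_of_lt hln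
  have hn' : (0 : ℝ) < n := by positivity
  have hm' : (0 : ℝ) < m := by positivity
  have hl' : (0 : ℝ) < l := by positivity
  have hd' : (0 : ℝ) < d := by positivity
  have hmr : (d : ℝ) * n = k * m := by exact_mod_cast hm
  rw [sqrt_mul_mul_div_sqrt hd' hl', sqrt_mul_mul_div_sqrt hd' hnl, sqrt_mul_div_sqrt_mul hd' hn']
  have h1 : (∏ c, √(n * cellPmf (w1star k) c) *
        poissonWeight (n * cellPmf (w1star k) c) (overlapCount n l r c) /
        (√(d * (n * cellPmf (w1star k) c)) *
          poissonWeight (d * (n * cellPmf (w1star k) c)) (d * overlapCount n l r c))) =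
      (√d)⁻¹ ^ 4 * ∏ c, poissonWeight (n * cellPmf (w1star k) c) (overlapCount n l r c) /
        poissonWeight (d * (n * cellPmf (w1star k) c)) (d * overlapCount n l r c) := by
    have : (√(d : ℝ))⁻¹ ^ 4 = ∏ _c : Bool × Bool, (√(d : ℝ))⁻¹ := by simp
    rw [this, ← Finset.prod_mul_distrib]
    exact Finset.prod_congr rfl fun c _ => sqrt_mul_div_sqrt_mul hd' (mul_pos hn' (hq c)) _ _
  have h2 : ∏ t, √(m * inPmf (wstar k) t) = √m ^ 3 * √(∏ t, inPmf (wstar k) t) := by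
    rw [Real.sqrt_prod _ fun t _ => (hp t).le]
    simp only [Real.sqrt_mul hm'.le]
    rw [Finset.prod_mul_distrib]
    simp
  rw [h1, Finset.prod_mul_distrib, h2, overlapTerm, limitScale]
  have hP : 0 < √(∏ t, inPmf (wstar k) t) :=
    Real.sqrt_pos.mpr (Finset.prod_pos fun t _ => hp t)
  have hn2 : (n : ℝ) = k * √m ^ 2 / d := by
    rw [Real.sq_sqrt hm'.le]
    field_simp
    linarith
  have hsd : 0 < √(d : ℝ) := Real.sqrt_pos.mpr hd'
  have hsm : 0 < √(m : ℝ) := Real.sqrt_pos.mpr hm'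
  generalize (∏ t, poissonWeight (m * inPmf (wstar k) t) (typeCount m (d * r) s t)) = X₁
  generalize (∏ c, poissonWeight (n * cellPmf (w1star k) c) (overlapCount n l r c) /
    poissonWeight (d * (n * cellPmf (w1star k) c)) (d * overlapCount n l r c)) = X₂
  generalize poissonWeight (d * l) (d * l) / poissonWeight l l = X₃
  generalize poissonWeight (d * (n - l : ℕ)) (d * (n - l : ℕ)) /
    poissonWeight (n - l : ℕ) (n - l : ℕ) = X₄
  generalize poissonWeight n n / poissonWeight (d * n) (d * n) = X₅
  rw [hn2, mul_pow, mul_pow, mul_pow, mul_pow, div_eq_mul_inv X₁]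
  generalize √(∏ t, inPmf (wstar k) t) = P at hP
  have : √(m : ℝ) ^ 3 * P * X₁ / (√m * poissonWeight m m) =
      √m ^ 2 * P * X₁ * (poissonWeight m m)⁻¹ := by
    field_simp
  rw [this]
  generalize (poissonWeight m m)⁻¹ = X₆
  field_simp

/-- The local limit theorem for the terms of the moment ratio. -/
theorem tendsto_mul_overlapTerm {k d : ℕ} (hk : 3 < k) (hd : 1 < d) (u : ℝ × ℝ) :
    Tendsto (fun n : ℕ => n * overlapTerm k d n (numConstraints k d n) (numOnes k n)
      (latticePoint k d n u).1 (latticePoint k d n u).2) (atTop ⊓ 𝓟 (admissible k d))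
      (𝓝 (limitScale k d / (2 * Real.pi) * Real.exp (-limitForm k d u))) := by
  set F := atTop ⊓ 𝓟 (admissible k d)
  have hF : F ≤ atTop := inf_le_left
  have hadm : ∀ᶠ n in F, n ∈ admissible k d := eventually_inf_principal.mpr (by simp)
  have hq := cellPmf_pos (w1star_pos hk) (w1star_lt_one hk)
  have hp := inPmf_wstar_pos hk
  have hw0 := w1star_pos hk
  have hw1 : 0 < 1 - w1star k := sub_pos.mpr (w1star_lt_one hk)
  have hk' : (0 : ℝ) < k := by positivity
  have hd0 : 0 < d := by omega
  have hd' : (0 : ℝ) < d := by positivity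
  have hm : ∀ᶠ n in F, (numConstraints k d n : ℝ) = n * (d / k) := by
    filter_upwards [hadm] with n hn
    have : (d : ℝ) * n = k * numConstraints k d n := by exact_mod_cast mul_numConstraints hn
    field_simp
    linarith
  have hl : ∀ᶠ n in F, (numOnes k n : ℝ) = n * w1star k := by
    filter_upwards [hadm] with n hn
    have : (k : ℝ) * numOnes k n = 2 * n := by exact_mod_cast mul_numOnes hn
    rw [w1star]
    field_simp
    linarith
  have hln : ∀ᶠ n in F, 0 < n ∧ 0 < numConstraints k d n ∧ 0 < numOnes k n ∧ numOnes k n < n := by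
    filter_upwards [hm, hl, hadm] with n h1 h2 h3
    have hn : 0 < n := h3.1
    have hn' : (0 : ℝ) < n := by positivity
    refine ⟨hn, ?_, ?_, ?_⟩
    · have : (0 : ℝ) < numConstraints k d n := by rw [h1]; positivity
      exact_mod_cast this
    · have : (0 : ℝ) < numOnes k n := by rw [h2]; positivity
      exact_mod_cast this
    · have : (numOnes k n : ℝ) < n := by rw [h2]; nlinarith
      exact_mod_cast this
  have hnl : ∀ᶠ n in F, ((n - numOnes k n : ℕ) : ℝ) = n * (1 - w1star k) := by
    filter_upwards [hl, hln] with n h1 h2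
    rw [Nat.cast_sub h2.2.2.2.le, h1]
    ring
  have hr : Tendsto (fun n : ℕ => (((latticePoint k d n u).1 : ℝ) - n * w1star k ^ 2) / √n) F
      (𝓝 u.1) := (tendsto_floor_sub_div _ u.1).mono_left hF
  have hs : Tendsto (fun n : ℕ => (((latticePoint k d n u).2 : ℝ) -
      numConstraints k d n * w2star k) / √n) F (𝓝 u.2) :=
    (tendsto_floor_sub_div _ u.2).mono_left hF
  -- the constraint types
  set y : Fin 3 → ℝ := ![u.2 - d * u.1, d * u.1 - 2 * u.2, u.2] with hy
  have hT : ∀ t, Tendsto (fun n : ℕ => √(numConstraints k d n * inPmf (wstar k) t) *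
      poissonWeight (numConstraints k d n * inPmf (wstar k) t)
        (typeCount (numConstraints k d n) (d * (latticePoint k d n u).1)
          (latticePoint k d n u).2 t)) F
      (𝓝 (Real.exp (-(y t ^ 2 / (2 * (d / k * inPmf (wstar k) t)))) / √(2 * Real.pi))) := fun t => by
    refine tendsto_sqrt_mul_poissonWeight_of_linear hF (by have := hp t; positivity) ?_ ?_
    · filter_upwards [hm] with n hn
      rw [hn, mul_assoc]
    · have hw : w1star k = 2 / k := rfl
      fin_cases t
      · refine (hs.sub (hr.const_mul (d : ℝ))).congr' ?_
        filter_upwards [hm] with n hn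
        simp [typeCount, inPmf, wstar]
        rw [mul_div_assoc', ← sub_div]
        congr 1
        rw [hn, hw]
        field_simp
        ring
      · refine ((hr.const_mul (d : ℝ)).sub (hs.const_mul 2)).congr' ?_
        filter_upwards [hm] with n hn
        simp [typeCount, inPmf, wstar]
        rw [mul_div_assoc', mul_div_assoc', ← sub_div]
        congr 1
        rw [hn, hw]
        field_simp
        ring
      · refine hs.congr' ?_
        filter_upwards [hm] with n hn
        simp [typeCount, inPmf, wstar]
  -- the variable types
  set σ : Bool × Bool → ℝ := fun c => bif c.1 == c.2 then 1 else -1 with hσ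
  have hdev : ∀ c, Tendsto (fun n : ℕ => ((overlapCount n (numOnes k n) (latticePoint k d n u).1 c : ℝ) -
      n * cellPmf (w1star k) c) / √n) F (𝓝 (σ c * u.1)) := fun c => by
    refine (hr.const_mul (σ c)).congr' ?_
    filter_upwards [hl] with n hn
    rw [mul_div_assoc']
    congr 1
    rcases c with ⟨_ | _, _ | _⟩ <;> 
      simp [σ, overlapCount, cellPmf, bernoulliPmf, hn, -mul_eq_mul_left_iff] <;> ring
  have hσ2 : ∀ c, (σ c * u.1) ^ 2 = u.1 ^ 2 := fun c => by
    rcases c with ⟨_ | _, _ | _⟩ <;> simp [σ]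
  have hC : ∀ c, Tendsto (fun n : ℕ => √(n * cellPmf (w1star k) c) *
      poissonWeight (n * cellPmf (w1star k) c)
        (overlapCount n (numOnes k n) (latticePoint k d n u).1 c)) F
      (𝓝 (Real.exp (-(u.1 ^ 2 / (2 * cellPmf (w1star k) c))) / √(2 * Real.pi))) := fun c => by
    rw [← hσ2 c]
    exact tendsto_sqrt_mul_poissonWeight_of_linear hF (hq c) (Eventually.of_forall fun _ => rfl)
      (hdev c)
  have hC' : ∀ c, Tendsto (fun n : ℕ => √(d * (n * cellPmf (w1star k) c)) *
      poissonWeight (d * (n * cellPmf (w1star k) c))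
        (d * overlapCount n (numOnes k n) (latticePoint k d n u).1 c)) F
      (𝓝 (Real.exp (-((d * (σ c * u.1)) ^ 2 / (2 * (d * cellPmf (w1star k) c)))) /
        √(2 * Real.pi))) := fun c => by
    refine tendsto_sqrt_mul_poissonWeight_of_linear hF (mul_pos hd' (hq c))
      (Eventually.of_forall fun n => by ring) (((hdev c).const_mul (d : ℝ)).congr fun n => ?_)
    push_cast
    ring
  have hself : ∀ (a : ℕ → ℕ) (κ : ℝ), 0 < κ → (∀ᶠ n in F, (a n : ℝ) = n * κ) →
      Tendsto (fun n => √(a n) * poissonWeight (a n) (a n)) F (𝓝 (1 / √(2 * Real.pi))) :=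
    fun a κ hκ h => tendsto_sqrt_mul_poissonWeight_self hF hκ h
      (Eventually.of_forall fun n => by simp)
  have hself' : ∀ (a : ℕ → ℕ) (κ : ℝ), 0 < κ → (∀ᶠ n in F, (a n : ℝ) = n * κ) →
      Tendsto (fun n => √(d * a n) * poissonWeight (d * a n) (d * a n)) F
        (𝓝 (1 / √(2 * Real.pi))) :=
    fun a κ hκ h => tendsto_sqrt_mul_poissonWeight_self (κ := d * κ) hF (by positivity)
      (h.mono fun n hn => by rw [hn]; ring) (Eventually.of_forall fun n => by simp)
  have hone : ∀ᶠ n : ℕ in F, (n : ℝ) = n * 1 := Eventually.of_forall fun n => (mul_one _).symm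
  have hg : (1 / √(2 * Real.pi)) ≠ 0 := by positivity
  have hlim := ((((tendsto_finsetProd Finset.univ fun t _ => hT t).div
    (hself _ (d / k) (by positivity) hm) hg).const_mul (limitScale k d))).mul
    ((tendsto_finsetProd Finset.univ fun c _ => (hC c).div (hC' c) (by positivity)).mul
      (((((hself' _ _ hw0 hl).div (hself _ _ hw0 hl) hg).mul
        ((hself' _ _ hw1 hnl).div (hself _ _ hw1 hnl) hg)).pow 2).mul
        ((hself _ _ one_pos hone).div (hself' _ _ one_pos hone) hg)))
  have hval : limitScale k d / (2 * Real.pi) * Real.exp (-limitForm k d u) =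
      limitScale k d * ((∏ t, Real.exp (-(y t ^ 2 / (2 * (d / k * inPmf (wstar k) t)))) /
        √(2 * Real.pi)) / (1 / √(2 * Real.pi))) *
      ((∏ c, (Real.exp (-(u.1 ^ 2 / (2 * cellPmf (w1star k) c))) / √(2 * Real.pi)) /
        (Real.exp (-((d * (σ c * u.1)) ^ 2 / (2 * (d * cellPmf (w1star k) c)))) /
          √(2 * Real.pi))) *
        (((1 / √(2 * Real.pi)) / (1 / √(2 * Real.pi)) *
          ((1 / √(2 * Real.pi)) / (1 / √(2 * Real.pi)))) ^ 2 *
          ((1 / √(2 * Real.pi)) / (1 / √(2 * Real.pi))))) := by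
    have hC2 : ∏ c, (Real.exp (-(u.1 ^ 2 / (2 * cellPmf (w1star k) c))) / √(2 * Real.pi)) /
        (Real.exp (-((d * (σ c * u.1)) ^ 2 / (2 * (d * cellPmf (w1star k) c)))) /
          √(2 * Real.pi)) =
        Real.exp (((d : ℝ) - 1) / 2 * (u.1 ^ 2 * ∑ c, (cellPmf (w1star k) c)⁻¹)) := by
      rw [Finset.mul_sum, Finset.mul_sum, Real.exp_sum]
      refine Finset.prod_congr rfl fun c _ => ?_
      rw [div_div_div_cancel_right₀ (by positivity), ← Real.exp_sub, mul_pow, hσ2]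
      congr 1
      have := (hq c).ne'
      field_simp
      ring
    have hT2 : (∏ t, Real.exp (-(y t ^ 2 / (2 * (d / k * inPmf (wstar k) t)))) /
        √(2 * Real.pi)) / (1 / √(2 * Real.pi)) =
        Real.exp (-∑ t, y t ^ 2 / (2 * (d / k * inPmf (wstar k) t))) / (2 * Real.pi) := by
      rw [Finset.prod_div_distrib, ← Real.exp_sum, Finset.sum_neg_distrib, Finset.prod_const,
        Finset.card_univ, Fintype.card_fin, pow_succ, Real.sq_sqrt (by positivity)]
      have : √(2 * Real.pi) ≠ 0 := by positivity
      generalize Real.exp (-∑ t, y t ^ 2 / (2 * (d / k * inPmf (wstar k) t))) = E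
      field_simp
    have hform : -limitForm k d u = -∑ t, y t ^ 2 / (2 * (d / k * inPmf (wstar k) t)) +
        ((d : ℝ) - 1) / 2 * (u.1 ^ 2 * ∑ c, (cellPmf (w1star k) c)⁻¹) := by
      rw [limitForm, Fin.sum_univ_three, hy]
      simp only [Matrix.cons_val_zero, Matrix.cons_val_one, Matrix.cons_val]
      have h0 := (hp 0).ne'
      have h1 := (hp 1).ne'
      have h2 := (hp 2).ne'
      field_simp
      ring
    rw [hC2, hT2, div_self hg, hform, Real.exp_add]
    ring
  rw [hval]
  refine hlim.congr' ?_
  filter_upwards [hadm, hln] with n h1 h2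
  exact (mul_overlapTerm_eq hk hd0 h2.1 h2.2.1 h2.2.2.1 h2.2.2.2 (mul_numConstraints h1) _ _).symm

open MeasureTheory

/-! ### The Gaussian integral -/

/-- The curvature of the limiting form in the second variable. -/
noncomputable def curvature (k d : ℕ) : ℝ := k ^ 2 * (k - 1) ^ 2 / (4 * d * (k - 3))

/-- The curvature of the limiting form in the first variable, after minimizing over the second. -/
noncomputable def schurCurvature (k d : ℕ) : ℝ := (k - d) * k ^ 3 / (8 * (k - 2) ^ 2)

lemma limitForm_eq {k d : ℕ} (hk : 3 < k) (hd : 0 < d) (u : ℝ × ℝ) :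
    limitForm k d u = curvature k d * (u.2 - d / (k - 2) * u.1) ^ 2 +
      schurCurvature k d * u.1 ^ 2 := by
  have h3 : (3 : ℝ) < k := by exact_mod_cast hk
  have hd' : (d : ℝ) ≠ 0 := by positivity
  have e0 : (k : ℝ) ≠ 0 := by linarith
  have e1 : (k : ℝ) - 1 ≠ 0 := by linarith
  have e2 : (k : ℝ) - 2 ≠ 0 := by linarith
  have e3 : (k : ℝ) - 3 ≠ 0 := by linarith
  have h1 : 1 - w1star k = (k - 2) / k := by
    rw [w1star]
    field_simp
  have hcell : ∑ c, (cellPmf (w1star k) c)⁻¹ = k ^ 4 / (4 * (k - 2) ^ 2) := by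
    simp only [Fintype.sum_prod_type, Fintype.sum_bool, cellPmf, bernoulliPmf, cond_true,
      cond_false, h1]
    rw [w1star]
    field_simp
    ring
  rw [limitForm, hcell, inPmf_wstar hk, curvature, schurCurvature]
  simp only [Matrix.cons_val_zero, Matrix.cons_val_one, Matrix.cons_val]
  field_simp
  ring

/-- A Gaussian integral over the plane, with the quadratic form in completed squares. -/
lemma integral_exp_neg_completed_square {a e : ℝ} (b : ℝ) (ha : 0 < a) (he : 0 < e) :
    ∫ u : ℝ × ℝ, Real.exp (-(a * (u.2 - b * u.1) ^ 2 + e * u.1 ^ 2)) = Real.pi / √(a * e) := by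
  have hsplit : ∀ x y : ℝ, Real.exp (-(a * (y - b * x) ^ 2 + e * x ^ 2)) =
      Real.exp (-e * x ^ 2) * Real.exp (-a * (y - b * x) ^ 2) := fun x y => by
    rw [← Real.exp_add]
    ring_nf
  have hinner : ∀ x : ℝ, ∫ y, Real.exp (-(a * (y - b * x) ^ 2 + e * x ^ 2)) =
      Real.exp (-e * x ^ 2) * √(Real.pi / a) := fun x => by
    simp only [hsplit]
    rw [integral_const_mul, integral_sub_right_eq_self (fun y => Real.exp (-a * y ^ 2)) (b * x),
      integral_gaussian]
  have hint : Integrable (fun u : ℝ × ℝ => Real.exp (-(a * (u.2 - b * u.1) ^ 2 + e * u.1 ^ 2)))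
      (volume.prod volume) := by
    refine (integrable_prod_iff (by fun_prop)).mpr ⟨Eventually.of_forall fun x => ?_, ?_⟩
    · simp only [hsplit]
      exact ((integrable_exp_neg_mul_sq ha).comp_sub_right (b * x)).const_mul _
    · simp only [Real.norm_eq_abs, Real.abs_exp, hinner]
      exact (integrable_exp_neg_mul_sq he).mul_const _
  rw [Measure.volume_eq_prod, integral_prod _ hint]
  simp only [hinner]
  rw [integral_mul_const, integral_gaussian, Real.sqrt_div' _ he.le, Real.sqrt_div' _ ha.le,
    Real.sqrt_mul ha.le, div_mul_div_comm, Real.mul_self_sqrt Real.pi_pos.le, mul_comm √e]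

/-- The value of the limiting integral. -/
lemma limitScale_mul_eq {k d : ℕ} (hk : 3 < k) (hd : 0 < d) (hdk : d < k) :
    limitScale k d / (2 * Real.pi) * (Real.pi / √(curvature k d * schurCurvature k d)) =
      √(((k : ℝ) - 1) / (k - d)) := by
  have h3 : (3 : ℝ) < k := by exact_mod_cast hk
  have hd' : (0 : ℝ) < d := by positivity
  have hdk' : (d : ℝ) < k := by exact_mod_cast hdk
  have e0 : (0 : ℝ) < k := by linarith
  have e1 : (0 : ℝ) < k - 1 := by linarith
  have e2 : (0 : ℝ) < k - 2 := by linarith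
  have e3 : (0 : ℝ) < k - 3 := by linarith
  have e4 : (0 : ℝ) < k - d := by linarith
  have hprod : ∏ i, inPmf (wstar k) i =
      8 * ((k : ℝ) - 2) ^ 2 * (k - 3) / (k ^ 3 * (k - 1) ^ 3) := by
    rw [inPmf_wstar hk, Fin.prod_univ_three]
    simp
    field_simp
    ring
  have hpos : 0 < ∏ i, inPmf (wstar k) i := Finset.prod_pos fun i _ => inPmf_wstar_pos hk i
  have hc : 0 < curvature k d * schurCurvature k d := by
    rw [curvature, schurCurvature]
    positivity
  have hpi := Real.pi_pos
  have hsp := Real.sqrt_pos.mpr hpos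
  have hsc := Real.sqrt_pos.mpr hc
  symm
  rw [Real.sqrt_eq_iff_eq_sq (by positivity) (by rw [limitScale]; positivity)]
  have : limitScale k d / (2 * Real.pi) * (Real.pi / √(curvature k d * schurCurvature k d)) =
      k / d * √d / (2 * √(∏ t, inPmf (wstar k) t) * √(curvature k d * schurCurvature k d)) := by
    rw [limitScale]
    field_simp
  rw [this, div_pow, mul_pow, mul_pow, mul_pow, Real.sq_sqrt hpos.le, Real.sq_sqrt hc.le,
    Real.sq_sqrt hd'.le, hprod, curvature, schurCurvature]
  field_simp
  ring

/-! ### From the sum to the integral -/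

/-- A finite lattice sum is the integral of the corresponding step function. -/
lemma sum_eq_integral_floor (f : ℤ → ℤ → ℝ) (R S : Finset ℤ)
    (hf : ∀ r s, ¬(r ∈ R ∧ s ∈ S) → f r s = 0) :
    ∑ r ∈ R, ∑ s ∈ S, f r s = ∫ x : ℝ × ℝ, f ⌊x.1⌋ ⌊x.2⌋ := by
  have hind : ∀ (r : ℤ) (x : ℝ), (Set.Ico (r : ℝ) (r + 1)).indicator (1 : ℝ → ℝ) x =
      if r = ⌊x⌋ then 1 else 0 := fun r x => by
    rw [Set.indicator_apply]
    refine if_congr ?_ rfl rfl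
    rw [eq_comm, Int.floor_eq_iff, Set.mem_Ico]
  have h1 : ∀ x : ℝ × ℝ, f ⌊x.1⌋ ⌊x.2⌋ = ∑ r ∈ R, ∑ s ∈ S, f r s *
      ((Set.Ico (r : ℝ) (r + 1)).indicator 1 x.1 * (Set.Ico (s : ℝ) (s + 1)).indicator 1 x.2) := by
    intro x
    simp only [hind]
    rw [Finset.sum_eq_single ⌊x.1⌋, Finset.sum_eq_single ⌊x.2⌋]
    · simp
    · intro s _ hs
      simp [hs]
    · intro hs
      rw [hf _ _ fun h => hs h.2, zero_mul]
    · intro r _ hr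
      simp [hr]
    · intro hr
      exact Finset.sum_eq_zero fun s _ => by rw [hf _ _ fun h => hr h.1, zero_mul]
  have hint : ∀ r : ℤ, Integrable ((Set.Ico (r : ℝ) (r + 1)).indicator (1 : ℝ → ℝ)) := fun r => by
    rw [integrable_indicator_iff measurableSet_Ico]
    exact integrableOn_const (by simp)
  have hone : ∀ r : ℤ, ∫ x, (Set.Ico (r : ℝ) (r + 1)).indicator (1 : ℝ → ℝ) x = 1 := fun r => by
    rw [integral_indicator_one measurableSet_Ico]
    simp
  have hint2 : ∀ r s : ℤ, Integrable (fun x : ℝ × ℝ => f r s *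
      ((Set.Ico (r : ℝ) (r + 1)).indicator 1 x.1 * (Set.Ico (s : ℝ) (s + 1)).indicator 1 x.2)) :=
    fun r s => ((hint r).mul_prod (hint s)).const_mul _
  simp only [h1]
  rw [integral_finsetSum _ fun r _ => integrable_finsetSum _ fun s _ => hint2 r s]
  refine Finset.sum_congr rfl fun r _ => ?_
  rw [integral_finsetSum _ fun s _ => hint2 r s]
  refine Finset.sum_congr rfl fun s _ => ?_
  rw [integral_const_mul, Measure.volume_eq_prod,
    integral_prod_mul (Set.indicator _ (1 : ℝ → ℝ)) (Set.indicator _ (1 : ℝ → ℝ)), hone, hone]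
  simp

/-- Recentring and rescaling of the integral of a step function. -/
lemma integral_floor_eq (f : ℤ → ℤ → ℝ) (a b : ℝ) {n : ℕ} (hn : 0 < n) :
    ∫ x : ℝ × ℝ, f ⌊x.1⌋ ⌊x.2⌋ = ∫ u : ℝ × ℝ, n * f ⌊a + √n * u.1⌋ ⌊b + √n * u.2⌋ := by
  have hn' : (0 : ℝ) < n := by positivity
  have h1 := integral_add_left_eq_self (μ := (volume : Measure (ℝ × ℝ)))
    (fun x : ℝ × ℝ => f ⌊x.1⌋ ⌊x.2⌋) (a, b)
  have h2 := Measure.integral_comp_smul (volume : Measure (ℝ × ℝ))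
    (fun x : ℝ × ℝ => f ⌊((a, b) + x).1⌋ ⌊((a, b) + x).2⌋) √(n : ℝ)
  rw [h1, Module.finrank_prod, Module.finrank_self, one_add_one_eq_two,
    Real.sq_sqrt hn'.le, abs_of_pos (by positivity), smul_eq_mul] at h2
  rw [integral_const_mul]
  simp only [Prod.smul_fst, Prod.smul_snd, Prod.fst_add, Prod.snd_add, smul_eq_mul] at h2
  rw [h2]
  field_simp

/-! ### Dominated convergence -/

/-- Rounding costs only a constant factor in the Gaussian bound. -/
lemma exp_floor_le {c a x : ℝ} (hc : 0 < c) {n : ℕ} (hn : 0 < n) :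
    Real.exp (-(c * ((⌊a + √n * x⌋ - a) ^ 2 / n))) ≤ Real.exp c * Real.exp (-(c / 2 * x ^ 2)) := by
  have hn' : (0 : ℝ) < n := by positivity
  have h1 := Int.floor_le (a + √n * x)
  have h2 := Int.lt_floor_add_one (a + √n * x)
  rw [← Real.exp_add]
  apply Real.exp_le_exp.mpr
  have h3 : x ^ 2 / 2 - 1 ≤ (⌊a + √n * x⌋ - a) ^ 2 / n := by
    rw [le_div_iff₀ hn']
    have h4 : x ^ 2 * n = (√n * x) ^ 2 := by
      rw [mul_pow, Real.sq_sqrt hn'.le, mul_comm]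
    have h5 : (1 : ℝ) ≤ n := by exact_mod_cast hn
    have h6 : (x ^ 2 / 2 - 1) * n = (√n * x) ^ 2 / 2 - n := by rw [← h4]; ring
    rw [h6]
    generalize √n * x = z at *
    nlinarith [sq_nonneg (z - 2 * (a + z - ⌊a + z⌋)), sq_nonneg (a + z - ⌊a + z⌋)]
  have := mul_le_mul_of_nonneg_left h3 hc.le
  linarith

lemma admissible_pos {k d n : ℕ} (hk : 3 < k) (hd : 0 < d) (hn : n ∈ admissible k d) :
    0 < n ∧ 0 < numConstraints k d n ∧ numOnes k n < n := by
  have h1 := mul_numConstraints hn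
  have h2 := mul_numOnes hn
  have hn0 : 0 < n := hn.1
  refine ⟨hn0, Nat.pos_of_ne_zero fun h => ?_, by nlinarith⟩
  rw [h] at h1
  have := Nat.mul_pos hd hn0
  omega

lemma norm_overlapTerm_latticePoint_le {k d : ℕ} (hk : 3 < k) (hd : 1 < d)
    (hconj : ContractionConjecture k) (hdk : (d : ℝ) < dstar k) :
    ∃ C > 0, ∃ c > 0, ∀ n ∈ admissible k d, ∀ u : ℝ × ℝ,
      ‖n * overlapTerm k d n (numConstraints k d n) (numOnes k n)
        (latticePoint k d n u).1 (latticePoint k d n u).2‖ ≤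
      C * (Real.exp (-(c * u.1 ^ 2)) * Real.exp (-(c * u.2 ^ 2))) := by
  obtain ⟨C, hC, c, hc, h⟩ := exists_overlapTerm_le_gaussian hk hd hconj hdk
  refine ⟨C * (Real.exp c * Real.exp c), by positivity, c / 2, by positivity, fun n hn u => ?_⟩
  obtain ⟨hn0, hm0, hln⟩ := admissible_pos hk (by omega) hn
  rw [Real.norm_of_nonneg (mul_nonneg (by positivity)
    (overlapTerm_nonneg hk (by omega) hn0 hm0 hln _ _))]
  refine (h n _ _ hn0 (mul_numConstraints hn) (mul_numOnes hn) _ _).trans ?_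
  rw [add_div, mul_add, neg_add, Real.exp_add, mul_assoc C]
  refine mul_le_mul_of_nonneg_left ?_ hC.le
  refine (mul_le_mul (exp_floor_le hc hn0) (exp_floor_le hc hn0) (Real.exp_pos _).le
    (by positivity)).trans_eq ?_
  ring

lemma admissible_neBot {k d : ℕ} (hk : 0 < k) : (atTop ⊓ 𝓟 (admissible k d)).NeBot := by
  rw [← frequently_mem_iff_neBot, frequently_atTop]
  exact fun a => ⟨k * (a + 1), by nlinarith, by positivity, ⟨d * (a + 1), by ring⟩,
    ⟨2 * (a + 1), by ring⟩⟩

/-- The Gaussian bound forces the limiting form to be positive definite, hence `d < k`. -/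
lemma lt_of_lt_dstar {k d : ℕ} (hk : 3 < k) (hd : 1 < d)
    (hconj : ContractionConjecture k) (hdk : (d : ℝ) < dstar k) : d < k := by
  have := admissible_neBot (k := k) (d := d) (by omega)
  obtain ⟨C, hC, c, hc, h⟩ := norm_overlapTerm_latticePoint_le hk hd hconj hdk
  have hbound : ∀ u : ℝ × ℝ, limitScale k d / (2 * Real.pi) * Real.exp (-limitForm k d u) ≤
      C * (Real.exp (-(c * u.1 ^ 2)) * Real.exp (-(c * u.2 ^ 2))) := fun u =>
    le_of_tendsto (tendsto_mul_overlapTerm hk hd u) (eventually_inf_principal.mpr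
      (Eventually.of_forall fun n hn => (le_abs_self _).trans (h n hn u)))
  by_contra hle
  have hle' : (k : ℝ) ≤ d := by exact_mod_cast not_lt.mp hle
  have hk' : (0 : ℝ) < k := by positivity
  set A := limitScale k d / (2 * Real.pi)
  have hA : 0 < A := by
    have hpos : 0 < ∏ t, inPmf (wstar k) t := Finset.prod_pos fun t _ => inPmf_wstar_pos hk t
    have := Real.pi_pos
    have : (0 : ℝ) < d := by positivity
    simp only [A, limitScale]
    positivity
  -- along this line the form is non-positive, so the limit is at least `A`, while the bound at
  -- this point is at most `C exp (-C / A) < A`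
  have hline := hbound (√(C / (A * c)), d / (k - 2) * √(C / (A * c)))
  rw [limitForm_eq hk (by omega)] at hline
  have hsq : √(C / (A * c)) ^ 2 = C / (A * c) := Real.sq_sqrt (by positivity)
  simp only [sub_self, hsq] at hline
  have hs : schurCurvature k d ≤ 0 := by
    rw [schurCurvature]
    refine div_nonpos_of_nonpos_of_nonneg ?_ (by positivity)
    exact mul_nonpos_of_nonpos_of_nonneg (by linarith) (by positivity)
  have h1 : 1 ≤ Real.exp (-(curvature k d * 0 ^ 2 + schurCurvature k d * (C / (A * c)))) := by
    apply Real.one_le_exp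
    have : schurCurvature k d * (C / (A * c)) ≤ 0 :=
      mul_nonpos_of_nonpos_of_nonneg hs (by positivity)
    linarith
  have h2 : Real.exp (-(c * (C / (A * c)))) ≤ (1 + C / A)⁻¹ := by
    rw [Real.exp_neg, show c * (C / (A * c)) = C / A by field_simp]
    gcongr
    linarith [Real.add_one_le_exp (C / A)]
  have h3 : Real.exp (-(c * (d / (k - 2) * √(C / (A * c))) ^ 2)) ≤ 1 :=
    Real.exp_le_one_iff.mpr (neg_nonpos.mpr (by positivity))
  have h4 : A ≤ C * ((1 + C / A)⁻¹ * 1) :=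
    calc A = A * 1 := (mul_one A).symm
      _ ≤ _ := mul_le_mul_of_nonneg_left h1 hA.le
      _ ≤ _ := hline
      _ ≤ _ := by gcongr
  rw [mul_one, ← div_eq_mul_inv, le_div_iff₀ (by positivity), mul_add, mul_div_cancel₀ _ hA.ne'] at h4
  linarith

/-- Dominated convergence for the step functions whose integral is the moment ratio. -/
theorem tendsto_moment_ratio {k d : ℕ} (hk : 3 < k) (hd : 1 < d)
    (hconj : ContractionConjecture k) (hdk : (d : ℝ) < dstar k) :
    Tendsto (fun n : ℕ => moment k d 2 n / moment k d 1 n ^ 2) (atTop ⊓ 𝓟 (admissible k d))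
      (𝓝 √(((k : ℝ) - 1) / (k - d))) := by
  have hlt := lt_of_lt_dstar hk hd hconj hdk
  have hlt' : (d : ℝ) < k := by exact_mod_cast hlt
  have h3 : (3 : ℝ) < k := by exact_mod_cast hk
  have hd' : (0 : ℝ) < d := by positivity
  have e1 : (0 : ℝ) < k - 1 := by linarith
  have e2 : (0 : ℝ) < k - 2 := by linarith
  have e3 : (0 : ℝ) < k - 3 := by linarith
  have e4 : (0 : ℝ) < k - d := by linarith
  have hcurv : 0 < curvature k d := by rw [curvature]; positivity
  have hschur : 0 < schurCurvature k d := by rw [schurCurvature]; positivity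
  obtain ⟨C, hC, c, hc, hle⟩ := norm_overlapTerm_latticePoint_le hk hd hconj hdk
  have hval : ∫ u : ℝ × ℝ, limitScale k d / (2 * Real.pi) * Real.exp (-limitForm k d u) =
      √(((k : ℝ) - 1) / (k - d)) := by
    simp only [limitForm_eq hk (show 0 < d by omega)]
    rw [integral_const_mul, integral_exp_neg_completed_square _ hcurv hschur,
      limitScale_mul_eq hk (by omega) hlt]
  rw [← hval]
  have hdct : Tendsto (fun n : ℕ => ∫ u : ℝ × ℝ, n * overlapTerm k d n (numConstraints k d n)
      (numOnes k n) (latticePoint k d n u).1 (latticePoint k d n u).2)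
      (atTop ⊓ 𝓟 (admissible k d))
      (𝓝 (∫ u : ℝ × ℝ, limitScale k d / (2 * Real.pi) * Real.exp (-limitForm k d u))) := by
    refine tendsto_integral_filter_of_dominated_convergence
      (fun u => C * (Real.exp (-(c * u.1 ^ 2)) * Real.exp (-(c * u.2 ^ 2)))) ?_ ?_ ?_ ?_
    · refine Eventually.of_forall fun n => Measurable.aestronglyMeasurable ?_
      have h1 : Measurable fun u : ℝ × ℝ => latticePoint k d n u :=
        (Int.measurable_floor.comp (by fun_prop)).prodMk (Int.measurable_floor.comp (by fun_prop))
      have h2 : Measurable fun p : ℤ × ℤ => (n : ℝ) * overlapTerm k d n (numConstraints k d n)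
        (numOnes k n) p.1 p.2 := measurable_of_countable _
      exact h2.comp h1
    · exact eventually_inf_principal.mpr (Eventually.of_forall fun n hn =>
        Eventually.of_forall fun u => hle n hn u)
    · have h1 : Integrable fun x : ℝ => Real.exp (-(c * x ^ 2)) := by
        simpa only [neg_mul] using integrable_exp_neg_mul_sq hc
      exact (h1.mul_prod h1).const_mul C
    · exact Eventually.of_forall fun u => tendsto_mul_overlapTerm hk hd u
  refine hdct.congr' ?_
  refine eventually_inf_principal.mpr (Eventually.of_forall fun n hn => ?_)
  obtain ⟨hn0, -, hln⟩ := admissible_pos hk (by omega) hn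
  symm
  beta_reduce
  rw [moment_two_div_sq hk (by omega) hn0 (mul_numConstraints hn) (mul_numOnes hn),
    sum_eq_integral_floor _ _ _ fun r s => overlapTerm_eq_zero_of_notMem hln.le,
    integral_floor_eq _ (n * w1star k ^ 2) (numConstraints k d n * w2star k) hn0]
  rfl

end Occupation

theorem mainTheorem5 (k d : ℕ) (hk : 3 < k) (hd : 1 < d)
    (hconj : Occupation.ContractionConjecture k) (hdk : (d : ℝ) < Occupation.dstar k) :
    (Occupation.wstar k ∈ Occupation.domain ∧
      Occupation.phi2 k d (Occupation.wstar k) = 0 ∧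
      ∀ w ∈ Occupation.domain, w ≠ Occupation.wstar k → 0 < Occupation.phi2 k d w) ∧
    Occupation.hessian (Occupation.phi2 k d) (Occupation.wstar k) =
      !![((d : ℝ) * ((k : ℝ) ^ 2 - k + 2) + (k : ℝ) ^ 2 * ((k : ℝ) - 3)) /
            (((k : ℝ) - 2) ^ 2 * ((k : ℝ) - 3)),
          -((d : ℝ) * ((k : ℝ) - 1) ^ 2 / (((k : ℝ) - 2) * ((k : ℝ) - 3)));
         -((d : ℝ) * ((k : ℝ) - 1) ^ 2 / (((k : ℝ) - 2) * ((k : ℝ) - 3))),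
          (d : ℝ) * ((k : ℝ) - 1) ^ 2 / (2 * ((k : ℝ) - 3))] ∧
    (fun n : ℕ => Occupation.moment k d 2 n / Occupation.moment k d 1 n ^ 2)
      ~[atTop ⊓ 𝓟 (Occupation.admissible k d)] (fun _ => Occupation.laplaceConstant k d) ∧
    Occupation.laplaceConstant k d = √(((k : ℝ) - 1) / ((k : ℝ) - d)) := by
  have hlt : (d : ℝ) < k := by exact_mod_cast Occupation.lt_of_lt_dstar hk hd hconj hdk
  have hk1 : (3 : ℝ) < k := by exact_mod_cast hk
  refine ⟨⟨Occupation.wstar_mem_domain hk, Occupation.phi2_wstar, fun w hw hne =>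
    Occupation.phi2_pos hk hd hconj hdk hw hne⟩, Occupation.hessian_phi2 hk, ?_,
    Occupation.laplaceConstant_eq hk hd⟩
  rw [Occupation.laplaceConstant_eq hk hd]
  refine (isEquivalent_const_iff_tendsto ?_).mpr
    (Occupation.tendsto_moment_ratio hk hd hconj hdk)
  exact (Real.sqrt_pos.mpr (div_pos (by linarith) (by linarith))).ne'
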